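/- **Setting.** Let $\mathcal D$ be the space of smooth compactly supported functions $\mathbb R\to\mathbb C$. For $q\in\mathbb N_0$ let $A_q$ be the set of $\varphi\in\mathcal D$ with $\int\varphi=1$ and $\int x^j\varphi(x)\,dx=0$ for $1\le j\le q$. For $\varphi\in A_0$ and $\varepsilon>0$ put $\varphi_\varepsilon(x)=\varepsilon^{-1}\varphi(\varepsilon^{-1}x)$ and $s(\varphi)=\sup\{|x|:\varphi(x)\neq0\}$. The Colombeau algebra is $\mathcal G(\mathbb R)=\mathcal E_M/\mathcal I$. Here $\mathcal E_M$ consists of the functions $F:A_0\times\mathbb R\to\mathbb C$, smooth in $x$, such that for every compact $K$ and $p\in\mathbb N_0$ there is $q$ with $\sup_{x\in K}|\partial_x^pF(\varphi_\varepsilon,x)|=O(\varepsilon^{-q})$ as $\varepsilon\to0_+$ for all $\varphi\in A_q$. The ideal $\mathcal I$ consists of those $F\in\mathcal E_M$ such that for every compact $K$ and $p\in\mathbb N_0$ there is $q$ with $\sup_{x\in K}|\partial_x^pF(\varphi_\varepsilon,x)|=O(\varepsilon^{r-q})$ for all $r\ge q$ and $\varphi\in A_r$. An element $U\in\mathcal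 G(\mathbb R)$ is associated with a distribution $u$, written $U\approx u$, if it has a representative $F$ such that for every $\psi\in\mathcal D$ there is $q$ with $\lim_{\varepsilon\to0_+}\int F(\varphi_\varepsilon,x)\psi(x)\,dx=\langle u,\psi\rangle$ for all $\varphi\in A_q$. **The $\delta$-model.** For $s>0$ let $D(s,\cdot)\in\mathcal D$ be even with $$\frac1s\int_{\mathbb R}D(s,x)^2\,dx=\int_{\mathbb R}D(s,x)\,dx=1,$$ and suppose that $D(s,\cdot)$ stays bounded in $\mathcal D$ as $s\to0_+$: for all sufficiently small $s$ the supports lie in one fixed interval $[-l,l]$, and for each $k$ there is a constant $C_k$ with $|\partial_x^kD(s,x)|\le C_k$ for all $x$ and all sufficiently small $s>0$. (For example, $D(s,x)=f(x)+\lambda_s g(x)$, where $f,g\in\mathcal D$ are real-valued and even with disjoint supports, $g\neq0$, $\int f=1$, $\int g=0$ and $\lambda_s^2=(s-\int f^2)/\int g^2$.) Put $D_\sigma(x)=\sigma^{-1}D(\sigma,x/\sigma)$. The model of a distribution $u$ is the element of $\mathcal G(\mathbb R)$ with representative $(\varphi,x)\mapsto(u*D_{s(\varphi)})(x)$. **The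 singularities.** Let $\theta$ be the Heaviside function, $\check\theta(x)=\theta(-x)$, $\ln x_+=\ln x$ for $x>0$ and $0$ for $x<0$, $\ln x_-=\ln(-x)$ for $x<0$ and $0$ for $x>0$, and, with distributional derivatives, $$x_+^{-2}=-\partial^2\ln x_+-\delta',\qquad x_-^{-2}=-\partial^2\ln x_-+\delta'.$$ Let $D,\ D',\ H,\ \check H,\ \mathrm{Ln}\,x_\pm,\ X_\pm^{-2}\in\mathcal G(\mathbb R)$ be the models of $\delta,\ \delta',\ \theta,\ \check\theta,\ \ln x_\pm,\ x_\pm^{-2}$, respectively. **Theorem.** One has $D\approx\delta$ and $D^2\approx\delta$, and $$X_-^{-2}\cdot H-\mathrm{Ln}\,x_+\cdot D'\ \approx\ -\delta,\qquad X_+^{-2}\cdot\check H+\mathrm{Ln}\,x_-\cdot D'\ \approx\ -\delta .$$ -/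

import Mathlib

open scoped Distributions ContDiff Topology Pointwise
open Filter MeasureTheory

namespace Colombeau

noncomputable section

/-- Complex-valued test functions on the real line. -/
abbrev Test : Type := 𝓓((⊤ : TopologicalSpace.Opens ℝ), ℂ)

/-- Complex-valued Schwartz distributions on the real line. -/
abbrev Distr : Type := Test →L[ℂ] ℂ

/-- A smooth compactly supported function as a test function. -/
def Test.of (f : ℝ → ℂ) (h : ContDiff ℝ ∞ f) (hc : HasCompactSupport f) : Test :=
  ⟨f, h, hc, fun _ _ => trivial⟩

/-- The function `x ↦ ε⁻¹ χ(ε⁻¹ x)`. -/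
def dilate (ε : ℝ) (χ : Test) : Test :=
  Test.of (fun x => (ε⁻¹ : ℂ) * χ (ε⁻¹ * x))
    (contDiff_const.mul (χ.contDiff.comp (contDiff_const.mul contDiff_id)))
    (by
      rcases eq_or_ne ε 0 with rfl | h
      · have e : (fun x : ℝ => (((0 : ℝ) : ℂ)⁻¹) * χ ((0 : ℝ)⁻¹ * x)) = 0 := by
          funext x; simp
        rw [e]
        exact HasCompactSupport.zero
      · exact (χ.hasCompactSupport.comp_homeomorph
          (Homeomorph.mulLeft₀ ε⁻¹ (inv_ne_zero h))).mul_left)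

/-- The function `y ↦ χ(x - y)`. -/
def reflect (χ : Test) (x : ℝ) : Test :=
  Test.of (fun y => χ (x - y)) (χ.contDiff.comp (contDiff_const.sub contDiff_id))
    (χ.hasCompactSupport.comp_homeomorph (Homeomorph.subLeft x))

@[simp] lemma dilate_apply (ε : ℝ) (χ : Test) (x : ℝ) :
    dilate ε χ x = (ε⁻¹ : ℂ) * χ (ε⁻¹ * x) := rfl

@[simp] lemma reflect_apply (χ : Test) (x y : ℝ) : reflect χ x y = χ (x - y) := rfl

/-! ### The Colombeau algebra -/

/-- The set `A_q` of test functions with integral `1` whose moments of order `1, …, q` vanish. -/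
def A (q : ℕ) : Set Test :=
  {φ | ∀ j ≤ q, ∫ x : ℝ, (x : ℂ) ^ j * φ x = if j = 0 then 1 else 0}

lemma A_anti {q r : ℕ} (h : q ≤ r) : A r ⊆ A q := fun _ hφ j hj => hφ j (hj.trans h)

lemma dilate_mem_A {ε : ℝ} (hε : 0 < ε) {q : ℕ} {φ : Test} (hφ : φ ∈ A q) :
    dilate ε φ ∈ A q := by
  intro j hj
  have h := hφ j hj
  have key : ∀ x : ℝ, (x : ℂ) ^ j * dilate ε φ x =
      (ε : ℂ) ^ j * (ε⁻¹ : ℂ) * (fun y : ℝ => (y : ℂ) ^ j * φ y) (ε⁻¹ * x) := by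
    intro x
    have : (ε : ℂ) ≠ 0 := by exact_mod_cast hε.ne'
    simp only [dilate_apply]
    push_cast
    rw [mul_pow, inv_pow]
    field_simp
  simp_rw [key]
  rw [integral_const_mul,
    Measure.integral_comp_mul_left (fun y : ℝ => (y : ℂ) ^ j * φ y) ε⁻¹, h]
  rcases eq_or_ne j 0 with rfl | hj0
  · have : (ε : ℂ) ≠ 0 := by exact_mod_cast hε.ne'
    simp [abs_of_pos hε, this]
  · simp [hj0]

/-- The net `φ_ε(x) = ε⁻¹ φ(ε⁻¹ x)` in `A_0`, for `ε > 0` (other values of `ε` are never used). -/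
def scale (ε : ℝ) (φ : A 0) : A 0 :=
  if h : 0 < ε then ⟨dilate ε φ, dilate_mem_A h φ.2⟩ else φ

/-- `s(φ) = sup {|x| : φ(x) ≠ 0}`. -/
def size (φ : Test) : ℝ := sSup ((fun x : ℝ => |x|) '' Function.support φ)

/-- Moderate functions `F(φ, x)`, smooth in `x`. -/
def IsModerate (F : A 0 → ℝ → ℂ) : Prop :=
  (∀ φ, ContDiff ℝ ∞ (F φ)) ∧
  ∀ (K : Set ℝ), IsCompact K → ∀ p : ℕ, ∃ q : ℕ, ∀ φ : A 0, (φ : Test) ∈ A q →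
    ∃ C : ℝ, ∀ᶠ ε in 𝓝[>] (0 : ℝ), ∀ x ∈ K,
      ‖iteratedDeriv p (F (scale ε φ)) x‖ ≤ C * (ε⁻¹) ^ q

/-- Null functions `F(φ, x)`. -/
def IsNull (F : A 0 → ℝ → ℂ) : Prop :=
  ∀ (K : Set ℝ), IsCompact K → ∀ p : ℕ, ∃ q : ℕ, ∀ r ≥ q, ∀ φ : A 0, (φ : Test) ∈ A r →
    ∃ C : ℝ, ∀ᶠ ε in 𝓝[>] (0 : ℝ), ∀ x ∈ K,
      ‖iteratedDeriv p (F (scale ε φ)) x‖ ≤ C * ε ^ (r - q)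

lemma eventually_small : ∀ᶠ ε in 𝓝[>] (0 : ℝ), 0 < ε ∧ ε < 1 := by
  filter_upwards [Ioo_mem_nhdsGT (show (0 : ℝ) < 1 by norm_num)] with ε h using h

/-- In the moderateness estimates one exponent can be used for all derivatives of order `≤ p`. -/
lemma IsModerate.uniform {F : A 0 → ℝ → ℂ} (hF : IsModerate F) {K : Set ℝ} (hK : IsCompact K)
    (p : ℕ) : ∃ q₀ : ℕ, ∀ q ≥ q₀, ∀ φ : A 0, (φ : Test) ∈ A q → ∃ C : ℝ, 0 ≤ C ∧
      ∀ᶠ ε in 𝓝[>] (0 : ℝ), ∀ i ≤ p, ∀ x ∈ K,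
        ‖iteratedDeriv i (F (scale ε φ)) x‖ ≤ C * (ε⁻¹) ^ q := by
  choose Q hQ using hF.2 K hK
  refine ⟨(Finset.range (p + 1)).sup Q, fun q hq φ hφ => ?_⟩
  have hQq : ∀ i ≤ p, Q i ≤ q := fun i hi =>
    (Finset.le_sup (Finset.mem_range.2 (by omega))).trans hq
  choose! C hC using fun i (hi : i ≤ p) => hQ i φ (A_anti (hQq i hi) hφ)
  refine ⟨∑ i ∈ Finset.range (p + 1), |C i|, Finset.sum_nonneg fun _ _ => abs_nonneg _, ?_⟩
  have h1 : ∀ᶠ ε in 𝓝[>] (0 : ℝ), ∀ i ∈ Finset.range (p + 1), ∀ x ∈ K,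
      ‖iteratedDeriv i (F (scale ε φ)) x‖ ≤ C i * (ε⁻¹) ^ Q i :=
    (Finset.eventually_all _).2 fun i hi => hC i (by simpa [Nat.lt_succ_iff] using hi)
  filter_upwards [h1, eventually_small] with ε h ⟨h0, hlt⟩ i hi x hx
  have hinv : 1 ≤ ε⁻¹ := (one_le_inv₀ h0).2 hlt.le
  have hmem : i ∈ Finset.range (p + 1) := Finset.mem_range.2 (by omega)
  calc _ ≤ C i * (ε⁻¹) ^ Q i := h i hmem x hx
    _ ≤ |C i| * (ε⁻¹) ^ Q i := by gcongr; exact le_abs_self _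
    _ ≤ (∑ i ∈ Finset.range (p + 1), |C i|) * (ε⁻¹) ^ q := by
        gcongr
        · exact Finset.single_le_sum (f := fun i => |C i|) (fun _ _ => abs_nonneg _) hmem
        · exact hQq i hi

lemma IsNull.uniform {F : A 0 → ℝ → ℂ} (hF : IsNull F) {K : Set ℝ} (hK : IsCompact K)
    (p : ℕ) : ∃ q₀ : ℕ, ∀ q ≥ q₀, ∀ r ≥ q, ∀ φ : A 0, (φ : Test) ∈ A r → ∃ C : ℝ, 0 ≤ C ∧
      ∀ᶠ ε in 𝓝[>] (0 : ℝ), ∀ i ≤ p, ∀ x ∈ K,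
        ‖iteratedDeriv i (F (scale ε φ)) x‖ ≤ C * ε ^ (r - q) := by
  choose Q hQ using hF K hK
  refine ⟨(Finset.range (p + 1)).sup Q, fun q hq r hr φ hφ => ?_⟩
  have hQq : ∀ i ≤ p, Q i ≤ q := fun i hi =>
    (Finset.le_sup (Finset.mem_range.2 (by omega))).trans hq
  choose! C hC using fun i (hi : i ≤ p) => hQ i r ((hQq i hi).trans hr) φ hφ
  refine ⟨∑ i ∈ Finset.range (p + 1), |C i|, Finset.sum_nonneg fun _ _ => abs_nonneg _, ?_⟩
  have h1 : ∀ᶠ ε in 𝓝[>] (0 : ℝ), ∀ i ∈ Finset.range (p + 1), ∀ x ∈ K,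
      ‖iteratedDeriv i (F (scale ε φ)) x‖ ≤ C i * ε ^ (r - Q i) :=
    (Finset.eventually_all _).2 fun i hi => hC i (by simpa [Nat.lt_succ_iff] using hi)
  filter_upwards [h1, eventually_small] with ε h ⟨h0, hlt⟩ i hi x hx
  have hmem : i ∈ Finset.range (p + 1) := Finset.mem_range.2 (by omega)
  calc _ ≤ C i * ε ^ (r - Q i) := h i hmem x hx
    _ ≤ |C i| * ε ^ (r - Q i) := by gcongr; exact le_abs_self _
    _ ≤ (∑ i ∈ Finset.range (p + 1), |C i|) * ε ^ (r - q) := by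
        refine mul_le_mul ?_ ?_ (by positivity) (Finset.sum_nonneg fun _ _ => abs_nonneg _)
        · exact Finset.single_le_sum (f := fun i => |C i|) (fun _ _ => abs_nonneg _) hmem
        · exact pow_le_pow_of_le_one h0.le hlt.le (by have := hQq i hi; omega)

lemma contDiffAt_nat {f : ℝ → ℂ} (h : ContDiff ℝ ∞ f) (n : ℕ) (x : ℝ) : ContDiffAt ℝ n f x :=
  (h.of_le (by exact_mod_cast le_top)).contDiffAt

lemma norm_iteratedDeriv_mul_le {f g : ℝ → ℂ} (hf : ContDiff ℝ ∞ f) (hg : ContDiff ℝ ∞ g)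
    (p : ℕ) (x : ℝ) {a b : ℝ} (ha : ∀ i ≤ p, ‖iteratedDeriv i f x‖ ≤ a)
    (hb : ∀ i ≤ p, ‖iteratedDeriv i g x‖ ≤ b) :
    ‖iteratedDeriv p (f * g) x‖ ≤ 2 ^ p * (a * b) := by
  have ha0 : 0 ≤ a := (norm_nonneg _).trans (ha 0 (Nat.zero_le _))
  rw [iteratedDeriv_mul (contDiffAt_nat hf p x) (contDiffAt_nat hg p x)]
  calc _ ≤ ∑ i ∈ Finset.range (p + 1), (p.choose i : ℝ) * (a * b) := by
        refine norm_sum_le_of_le _ fun i hi => ?_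
        rw [mul_assoc, norm_mul, norm_mul, Complex.norm_natCast]
        have hi' : i ≤ p := by simpa [Nat.lt_succ_iff] using hi
        gcongr
        · exact ha i hi'
        · exact hb _ (Nat.sub_le _ _)
    _ = 2 ^ p * (a * b) := by
        rw [← Finset.sum_mul]
        congr 1
        exact_mod_cast Nat.sum_range_choose p

lemma IsModerate.mul {F G : A 0 → ℝ → ℂ} (hF : IsModerate F) (hG : IsModerate G) :
    IsModerate (F * G) := by
  refine ⟨fun φ => (hF.1 φ).mul (hG.1 φ), fun K hK p => ?_⟩
  obtain ⟨q₁, h₁⟩ := hF.uniform hK p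
  obtain ⟨q₂, h₂⟩ := hG.uniform hK p
  refine ⟨q₁ + q₂, fun φ hφ => ?_⟩
  obtain ⟨C, -, hC⟩ := h₁ q₁ le_rfl φ (A_anti (by omega) hφ)
  obtain ⟨C', -, hC'⟩ := h₂ q₂ le_rfl φ (A_anti (by omega) hφ)
  refine ⟨2 ^ p * (C * C'), ?_⟩
  filter_upwards [hC, hC'] with ε h h' x hx
  refine (norm_iteratedDeriv_mul_le (hF.1 _) (hG.1 _) p x (fun i hi => h i hi x hx)
    (fun i hi => h' i hi x hx)).trans (le_of_eq ?_)
  rw [pow_add]; ring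

lemma IsModerate.add {F G : A 0 → ℝ → ℂ} (hF : IsModerate F) (hG : IsModerate G) :
    IsModerate (F + G) := by
  refine ⟨fun φ => (hF.1 φ).add (hG.1 φ), fun K hK p => ?_⟩
  obtain ⟨q₁, h₁⟩ := hF.uniform hK p
  obtain ⟨q₂, h₂⟩ := hG.uniform hK p
  refine ⟨q₁ + q₂, fun φ hφ => ?_⟩
  obtain ⟨C, -, hC⟩ := h₁ (q₁ + q₂) (by omega) φ hφ
  obtain ⟨C', -, hC'⟩ := h₂ (q₁ + q₂) (by omega) φ hφ
  refine ⟨C + C', ?_⟩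
  filter_upwards [hC, hC'] with ε h h' x hx
  rw [Pi.add_apply, iteratedDeriv_add (contDiffAt_nat (hF.1 _) p x) (contDiffAt_nat (hG.1 _) p x),
    add_mul]
  exact norm_add_le_of_le (h p le_rfl x hx) (h' p le_rfl x hx)

lemma IsModerate.const (c : ℂ) : IsModerate (fun _ _ => c) := by
  refine ⟨fun φ => contDiff_const, fun K hK p => ⟨0, fun φ _ => ⟨‖c‖, ?_⟩⟩⟩
  filter_upwards with ε x _
  rcases p with _ | p
  · simp
  · simp [iteratedDeriv_const]

/-- The algebra of moderate functions. -/
def Moderate : Subalgebra ℂ (A 0 → ℝ → ℂ) where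
  carrier := {F | IsModerate F}
  mul_mem' := IsModerate.mul
  add_mem' := IsModerate.add
  algebraMap_mem' c := IsModerate.const c

/-- The ideal of null functions in the algebra of moderate functions. -/
def Null : Ideal Moderate where
  carrier := {F | IsNull F.1}
  zero_mem' := by
    intro K _ p
    refine ⟨0, fun r _ φ _ => ⟨0, ?_⟩⟩
    filter_upwards with ε x _
    simp
  add_mem' := by
    intro F G hF hG K hK p
    obtain ⟨q₁, h₁⟩ := hF.uniform hK p
    obtain ⟨q₂, h₂⟩ := hG.uniform hK p
    refine ⟨q₁ + q₂, fun r hr φ hφ => ?_⟩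
    obtain ⟨C, -, hC⟩ := h₁ (q₁ + q₂) (by omega) r hr φ hφ
    obtain ⟨C', -, hC'⟩ := h₂ (q₁ + q₂) (by omega) r hr φ hφ
    refine ⟨C + C', ?_⟩
    filter_upwards [hC, hC'] with ε h h' x hx
    change ‖iteratedDeriv p (F.1 (scale ε φ) + G.1 (scale ε φ)) x‖ ≤ _
    rw [iteratedDeriv_add (contDiffAt_nat (F.2.1 _) p x) (contDiffAt_nat (G.2.1 _) p x), add_mul]
    exact norm_add_le_of_le (h p le_rfl x hx) (h' p le_rfl x hx)
  smul_mem' := by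
    intro G F hF K hK p
    obtain ⟨q₁, h₁⟩ := IsModerate.uniform G.2 hK p
    obtain ⟨q₂, h₂⟩ := hF.uniform hK p
    refine ⟨q₁ + q₂, fun r hr φ hφ => ?_⟩
    obtain ⟨C, -, hC⟩ := h₁ q₁ le_rfl φ (A_anti (by omega) hφ)
    obtain ⟨C', -, hC'⟩ := h₂ q₂ le_rfl r (by omega) φ hφ
    refine ⟨2 ^ p * (C * C'), ?_⟩
    filter_upwards [hC, hC', eventually_small] with ε h h' ⟨h0, _⟩ x hx
    refine (norm_iteratedDeriv_mul_le (G.2.1 _) (F.2.1 _) p x (fun i hi => h i hi x hx)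
      (fun i hi => h' i hi x hx)).trans (le_of_eq ?_)
    have e : r - q₂ = q₁ + (r - (q₁ + q₂)) := by omega
    rw [e, pow_add, inv_pow]
    field_simp

/-- The Colombeau algebra of generalized functions on the real line. -/
abbrev G : Type := Moderate ⧸ Null

/-- The generalized function with the given moderate representative. -/
def G.mk (F : A 0 → ℝ → ℂ) (hF : IsModerate F) : G := Ideal.Quotient.mk Null ⟨F, hF⟩

/-- The generalized function `U` is associated with the distribution `u`. -/
def Assoc (U : G) (u : Distr) : Prop :=
  ∃ (F : A 0 → ℝ → ℂ) (hF : IsModerate F), U = G.mk F hF ∧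
    ∀ ψ : Test, ∃ q : ℕ, ∀ φ : A 0, (φ : Test) ∈ A q →
      Tendsto (fun ε : ℝ => ∫ x : ℝ, F (scale ε φ) x * ψ x) (𝓝[>] 0) (𝓝 (u ψ))


/-! ### Distributions -/

/-- The distributional derivative. -/
def Distr.deriv (u : Distr) : Distr := -(u.comp (TestFunction.lineDerivCLM ℂ (1 : ℝ)))

/-- The distribution given by a locally integrable function. -/
def Distr.ofFun (f : ℝ → ℂ) : Distr :=
  TestFunction.integralAgainstBilinCLM (ContinuousLinearMap.mul ℂ ℂ) volume f

/-- The Dirac distribution at `0`. -/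
def delta : Distr where
  toFun ψ := ψ 0
  map_add' _ _ := rfl
  map_smul' _ _ := rfl
  cont := continuous_eval_const _

def lnPlusFun (x : ℝ) : ℂ := if 0 < x then (Real.log x : ℂ) else 0
def lnMinusFun (x : ℝ) : ℂ := if x < 0 then (Real.log (-x) : ℂ) else 0
def heavisideFun (x : ℝ) : ℂ := if 0 < x then 1 else 0
def heavisideRefFun (x : ℝ) : ℂ := if x < 0 then 1 else 0

lemma locallyIntegrable_log : LocallyIntegrable (fun x : ℝ => (Real.log x : ℂ)) := by
  rw [locallyIntegrable_iff]
  intro K hK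
  obtain ⟨a, b, hab⟩ : ∃ a b : ℝ, K ⊆ Set.Ioc a b := by
    obtain ⟨R, hR⟩ := hK.isBounded.subset_closedBall 0
    exact ⟨-R - 1, R, fun x hx => by
      have := hR hx
      rw [Real.closedBall_eq_Icc] at this
      constructor <;> linarith [this.1, this.2]⟩
  refine IntegrableOn.mono_set ?_ hab
  rcases le_total a b with h | h
  · exact ((intervalIntegrable_iff_integrableOn_Ioc_of_le h).1
      intervalIntegral.intervalIntegrable_log').ofReal
  · simp [Set.Ioc_eq_empty (not_lt.2 h)]

lemma locallyIntegrable_lnPlusFun : LocallyIntegrable lnPlusFun := by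
  have h : lnPlusFun = (Set.Ioi (0 : ℝ)).indicator (fun x : ℝ => (Real.log x : ℂ)) := by
    funext x; simp [lnPlusFun, Set.indicator]
  rw [h]
  exact locallyIntegrable_log.indicator measurableSet_Ioi

lemma locallyIntegrable_lnMinusFun : LocallyIntegrable lnMinusFun := by
  have h : lnMinusFun = (Set.Iio (0 : ℝ)).indicator (fun x : ℝ => (Real.log x : ℂ)) := by
    funext x; simp [lnMinusFun, Set.indicator]
  rw [h]
  exact locallyIntegrable_log.indicator measurableSet_Iio

lemma locallyIntegrable_heavisideFun : LocallyIntegrable heavisideFun := by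
  have h : heavisideFun = (Set.Ioi (0 : ℝ)).indicator (fun _ : ℝ => (1 : ℂ)) := by
    funext x; simp [heavisideFun, Set.indicator]
  rw [h]
  exact (locallyIntegrable_const 1).indicator measurableSet_Ioi

lemma locallyIntegrable_heavisideRefFun : LocallyIntegrable heavisideRefFun := by
  have h : heavisideRefFun = (Set.Iio (0 : ℝ)).indicator (fun _ : ℝ => (1 : ℂ)) := by
    funext x; simp [heavisideRefFun, Set.indicator]
  rw [h]
  exact (locallyIntegrable_const 1).indicator measurableSet_Iio

/-- The distributions `ln x₊` and `ln x₋`. -/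
def lnPlus : Distr := Distr.ofFun lnPlusFun
def lnMinus : Distr := Distr.ofFun lnMinusFun

/-- The step function `θ` and its reflection `x ↦ θ(-x)`. -/
def heaviside : Distr := Distr.ofFun heavisideFun
def heavisideRef : Distr := Distr.ofFun heavisideRefFun

/-- The harmonic number `κ_p = 1 + 1/2 + ⋯ + 1/p`. -/
def kappa (p : ℕ) : ℂ := ∑ k ∈ Finset.Icc 1 p, (1 : ℂ) / k

/-- The distribution `x₊^{-(p+1)}`. -/
def negPowPlus (p : ℕ) : Distr :=
  ((-1) ^ p / (p.factorial : ℂ)) • Distr.deriv^[p + 1] lnPlus +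
    ((-1) ^ p * kappa p / (p.factorial : ℂ)) • Distr.deriv^[p] delta

/-- The distribution `x₋^{-(p+1)}`. -/
def negPowMinus (p : ℕ) : Distr :=
  (-1 / (p.factorial : ℂ)) • Distr.deriv^[p + 1] lnMinus +
    (kappa p / (p.factorial : ℂ)) • Distr.deriv^[p] delta

/-- The convolution `(u * χ)(x) = ⟨u_y, χ(x - y)⟩`. -/
def conv (u : Distr) (χ : Test) (x : ℝ) : ℂ := u (reflect χ x)

/-! ### Smoothness and bounds for the convolution -/

/-- The derivative of a test function. -/
def Test.deriv (χ : Test) : Test := TestFunction.lineDerivCLM ℂ (1 : ℝ) χ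

lemma Test.coe_deriv (χ : Test) : ⇑χ.deriv = _root_.deriv χ := by
  funext x
  have : χ.deriv x = lineDeriv ℝ χ x 1 := by simp [Test.deriv]
  rw [this]
  simp [lineDeriv, deriv_comp_const_add]

lemma Test.coe_deriv_iterate (χ : Test) (k : ℕ) : ⇑(Test.deriv^[k] χ) = iteratedDeriv k χ := by
  induction k with
  | zero => simp
  | succ k ih => rw [Function.iterate_succ_apply', Test.coe_deriv, ih, iteratedDeriv_succ]

/-- A distribution has finite order on each bounded interval. -/
lemma Distr.bound (u : Distr) (R : ℝ) : ∃ (N : ℕ) (C : ℝ), 0 ≤ C ∧ ∀ (ψ : Test) (B : ℝ), 0 ≤ B →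
    (∀ x, ψ x ≠ 0 → |x| ≤ R) → (∀ i ≤ N, ∀ x, ‖iteratedDeriv i ψ x‖ ≤ B) → ‖u ψ‖ ≤ C * B := by
  let K : TopologicalSpace.Compacts ℝ := ⟨Set.Icc (-R) R, isCompact_Icc⟩
  have hK : (K : Set ℝ) ⊆ ((⊤ : TopologicalSpace.Opens ℝ) : Set ℝ) := fun _ _ => trivial
  let v : 𝓓^{⊤}_{K}(ℝ, ℂ) →L[ℂ] ℂ := u.comp (TestFunction.ofSupportedInCLM ℂ hK)
  have hv : Continuous ((normSeminorm ℂ ℂ).comp v.toLinearMap) :=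
    continuous_norm.comp v.continuous
  obtain ⟨s, C, -, hC⟩ := Seminorm.bound_of_continuous
    (ContDiffMapSupportedIn.withSeminorms ℂ ℝ ℂ ⊤ K) _ hv
  refine ⟨s.sup id, C, C.2, fun ψ B hB hsupp hder => ?_⟩
  let f : 𝓓^{⊤}_{K}(ℝ, ℂ) := ⟨ψ, ψ.contDiff, fun x hx => by
    by_contra h
    exact hx (abs_le.1 (hsupp x h))⟩
  have e : u ψ = v f := rfl
  rw [e]
  refine (hC f).trans ?_
  change (C : ℝ) * _ ≤ _
  gcongr
  refine Seminorm.finset_sup_apply_le hB fun i hi => ?_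
  rw [ContDiffMapSupportedIn.seminorm_top_le_iff ℂ hB]
  intro x _
  rw [norm_iteratedFDeriv_eq_norm_iteratedDeriv]
  exact hder i (Finset.le_sup (f := id) hi) x

lemma Test.exists_support (χ : Test) : ∃ l : ℝ, ∀ x, χ x ≠ 0 → |x| ≤ l := by
  obtain ⟨R, hR⟩ := χ.hasCompactSupport.isBounded.subset_closedBall 0
  exact ⟨R, fun x hx => by simpa using hR (subset_tsupport _ hx)⟩

lemma Test.support_deriv (χ : Test) {l : ℝ} (hl : ∀ x, χ x ≠ 0 → |x| ≤ l) :
    ∀ x, χ.deriv x ≠ 0 → |x| ≤ l := by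
  intro x hx
  by_contra hcon
  apply hx
  rw [Test.coe_deriv]
  have : χ =ᶠ[𝓝 x] fun _ => 0 := by
    filter_upwards [(isOpen_lt continuous_const continuous_abs).mem_nhds (not_le.1 hcon)] with y hy
    by_contra h
    exact absurd (hl y h) (not_le.2 hy)
  rw [this.deriv_eq]; simp

lemma Test.support_deriv_iterate (χ : Test) {l : ℝ} (hl : ∀ x, χ x ≠ 0 → |x| ≤ l) (k : ℕ) :
    ∀ x, Test.deriv^[k] χ x ≠ 0 → |x| ≤ l := by
  induction k with
  | zero => simpa using hl
  | succ k ih => rw [Function.iterate_succ_apply']; exact Test.support_deriv _ ih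

lemma Test.exists_bound (χ : Test) (k : ℕ) : ∃ C : ℝ, 0 ≤ C ∧ ∀ x, ‖iteratedDeriv k χ x‖ ≤ C := by
  obtain ⟨C, hC⟩ := (Test.deriv^[k] χ).continuous.bounded_above_of_compact_support
    (Test.deriv^[k] χ).hasCompactSupport
  refine ⟨C, (norm_nonneg _).trans (hC 0), fun x => ?_⟩
  rw [← Test.coe_deriv_iterate]; exact hC x

lemma Test.exists_bound_le (χ : Test) (N : ℕ) :
    ∃ C : ℝ, 0 ≤ C ∧ ∀ k ≤ N, ∀ x, ‖iteratedDeriv k χ x‖ ≤ C := by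
  choose C h0 hC using χ.exists_bound
  refine ⟨∑ k ∈ Finset.range (N + 1), C k, Finset.sum_nonneg fun _ _ => h0 _, fun k hk x => ?_⟩
  exact (hC k x).trans (Finset.single_le_sum (f := C) (fun _ _ => h0 _)
    (Finset.mem_range.2 (by omega)))

lemma Test.hasDerivAt_iterate (χ : Test) (k : ℕ) (x : ℝ) :
    HasDerivAt (iteratedDeriv k χ) (iteratedDeriv (k + 1) χ x) x := by
  rw [← Test.coe_deriv_iterate, ← Test.coe_deriv_iterate, Function.iterate_succ_apply',
    Test.coe_deriv]
  exact ((Test.deriv^[k] χ).contDiff.differentiable (by simp)).differentiableAt.hasDerivAt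

/-- First order Taylor estimate, uniform in the point. -/
lemma taylor_bound (χ : Test) (k : ℕ) {M : ℝ}
    (hM : ∀ x, ‖iteratedDeriv (k + 2) χ x‖ ≤ M) (a h : ℝ) :
    ‖iteratedDeriv k χ (a + h) - iteratedDeriv k χ a - h * iteratedDeriv (k + 1) χ a‖
      ≤ M * h ^ 2 := by
  have lip : ∀ x y, ‖iteratedDeriv (k + 1) χ y - iteratedDeriv (k + 1) χ x‖ ≤ M * ‖y - x‖ :=
    fun x y => Convex.norm_image_sub_le_of_norm_hasDerivWithin_le
      (fun z _ => (χ.hasDerivAt_iterate (k + 1) z).hasDerivWithinAt) (fun z _ => hM z)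
      convex_univ trivial trivial
  have hM0 : 0 ≤ M := (norm_nonneg _).trans (hM 0)
  let g : ℝ → ℂ := fun t => iteratedDeriv k χ (a + t) - t * iteratedDeriv (k + 1) χ a
  have hg : ∀ t, HasDerivAt g
      (iteratedDeriv (k + 1) χ (a + t) - iteratedDeriv (k + 1) χ a) t := by
    intro t
    have h1 := (χ.hasDerivAt_iterate k (a + t)).comp_const_add a t
    have h2 := ((Complex.ofRealCLM.hasDerivAt (x := t)).mul_const (iteratedDeriv (k + 1) χ a))
    have h3 := h1.sub h2
    simp only [Complex.ofRealCLM_apply, Complex.ofReal_one, one_mul] at h3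
    exact h3
  have := Convex.norm_image_sub_le_of_norm_hasDerivWithin_le (s := Set.uIcc 0 h) (C := M * |h|)
    (fun t _ => (hg t).hasDerivWithinAt) (fun t ht => by
      refine (lip a (a + t)).trans ?_
      have : |t| ≤ |h| := by simpa using Set.abs_sub_left_of_mem_uIcc ht
      simpa using mul_le_mul_of_nonneg_left this hM0) (convex_uIcc 0 h)
    Set.left_mem_uIcc Set.right_mem_uIcc
  have e : g h - g 0 =
      iteratedDeriv k χ (a + h) - iteratedDeriv k χ a - h * iteratedDeriv (k + 1) χ a := by
    simp [g]; ring
  rw [e] at this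
  refine this.trans (le_of_eq ?_)
  rw [sub_zero, Real.norm_eq_abs, mul_assoc, abs_mul_abs_self, sq]

lemma iteratedDeriv_reflect (χ : Test) (x : ℝ) (i : ℕ) (y : ℝ) :
    iteratedDeriv i (reflect χ x) y = (-1) ^ i * iteratedDeriv i χ (x - y) := by
  have := congrFun (iteratedDeriv_comp_const_sub i χ x) y
  change iteratedDeriv i (fun z => χ (x - z)) y = _
  simpa using this

lemma conv_hasDerivAt (u : Distr) (χ : Test) (x : ℝ) :
    HasDerivAt (conv u χ) (conv u χ.deriv x) x := by
  obtain ⟨l, hl⟩ := χ.exists_support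
  have hl' := χ.support_deriv hl
  obtain ⟨N, C, hC0, hC⟩ := u.bound (|x| + 1 + l)
  obtain ⟨M, hM0, hM⟩ := χ.exists_bound_le (N + 2)
  have key : ∀ h : ℝ, |h| ≤ 1 →
      ‖conv u χ (x + h) - conv u χ x - h * conv u χ.deriv x‖ ≤ C * (M * h ^ 2) := by
    intro h hh
    have e : conv u χ (x + h) - conv u χ x - h * conv u χ.deriv x =
        u (reflect χ (x + h) - reflect χ x - (h : ℂ) • reflect χ.deriv x) := by
      simp [conv]
    rw [e]
    refine hC _ _ (by positivity) (fun y hy => ?_) (fun i hi y => ?_)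
    · by_contra hcon
      apply hy
      have h1 : χ (x + h - y) = 0 := by
        by_contra h0
        have := hl _ h0
        have := abs_sub_abs_le_abs_sub y (x + h)
        rw [abs_sub_comm] at this
        linarith [abs_add_le x h]
      have h2 : χ (x - y) = 0 := by
        by_contra h0
        have := hl _ h0
        have := abs_sub_abs_le_abs_sub y x
        rw [abs_sub_comm] at this
        linarith
      have h3 : χ.deriv (x - y) = 0 := by
        by_contra h0
        have := hl' _ h0
        have := abs_sub_abs_le_abs_sub y x
        rw [abs_sub_comm] at this
        linarith
      simp [h1, h2, h3]
    · have c : ∀ ψ : Test, ContDiffAt ℝ i ψ y := fun ψ => contDiffAt_nat ψ.contDiff i y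
      have e2 : ⇑(reflect χ (x + h) - reflect χ x - (h : ℂ) • reflect χ.deriv x) =
          ⇑(reflect χ (x + h)) - ⇑(reflect χ x) - (h : ℂ) • ⇑(reflect χ.deriv x) := rfl
      have c2 : ContDiffAt ℝ i (⇑(reflect χ (x + h)) - ⇑(reflect χ x)) y := (c _).sub (c _)
      have c3 : ContDiffAt ℝ i ((h : ℂ) • ⇑(reflect χ.deriv x)) y :=
        (c (reflect χ.deriv x)).const_smul (h : ℂ)
      rw [e2, iteratedDeriv_sub c2 c3,
        iteratedDeriv_sub (c _) (c _), iteratedDeriv_const_smul_field]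
      simp only [iteratedDeriv_reflect, smul_eq_mul]
      have e3 : iteratedDeriv i χ.deriv = iteratedDeriv (i + 1) χ := by
        rw [Test.coe_deriv, iteratedDeriv_succ']
      rw [e3]
      have e4 : (-1 : ℂ) ^ i * iteratedDeriv i χ (x + h - y) - (-1) ^ i * iteratedDeriv i χ (x - y)
          - h * ((-1) ^ i * iteratedDeriv (i + 1) χ (x - y)) =
          (-1) ^ i * (iteratedDeriv i χ (x - y + h) - iteratedDeriv i χ (x - y)
            - h * iteratedDeriv (i + 1) χ (x - y)) := by
        rw [show x + h - y = x - y + h by ring]; ring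
      rw [e4, norm_mul, norm_pow, norm_neg, norm_one, one_pow, one_mul]
      exact taylor_bound χ i (fun z => hM _ (by omega) z) _ _
  rw [hasDerivAt_iff_isLittleO_nhds_zero]
  have hO : (fun h : ℝ => conv u χ (x + h) - conv u χ x - h • conv u χ.deriv x) =O[𝓝 0]
      fun h : ℝ => h ^ 2 := by
    refine Asymptotics.IsBigO.of_bound (C * M) ?_
    filter_upwards [Metric.closedBall_mem_nhds (0 : ℝ) one_pos] with h hh
    have := key h (by simpa using hh)
    rw [Complex.real_smul, norm_pow, Real.norm_eq_abs, sq_abs, mul_assoc]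
    exact this
  exact hO.trans_isLittleO (Asymptotics.isLittleO_pow_id one_lt_two)

lemma iteratedDeriv_conv (u : Distr) (χ : Test) (k : ℕ) :
    iteratedDeriv k (conv u χ) = conv u (Test.deriv^[k] χ) := by
  induction k with
  | zero => simp
  | succ k ih =>
    rw [iteratedDeriv_succ, ih, Function.iterate_succ_apply']
    funext x
    exact (conv_hasDerivAt u _ x).deriv

lemma contDiff_conv (u : Distr) (χ : Test) : ContDiff ℝ ∞ (conv u χ) := by
  refine contDiff_of_differentiable_iteratedDeriv fun m _ => ?_
  rw [iteratedDeriv_conv]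
  exact fun x => (conv_hasDerivAt u _ x).differentiableAt


/-! ### Models of singularities -/

lemma bddAbove_size (φ : Test) : BddAbove ((fun x : ℝ => |x|) '' Function.support φ) := by
  obtain ⟨l, hl⟩ := φ.exists_support
  exact ⟨l, by rintro _ ⟨x, hx, rfl⟩; exact hl x hx⟩

lemma size_pos (φ : A 0) : 0 < size φ := by
  by_contra h
  have h0 : ∀ x : ℝ, x ≠ 0 → (φ : Test) x = 0 := by
    intro x hx
    by_contra hφ
    have := le_csSup (bddAbove_size φ) ⟨x, hφ, rfl⟩
    exact h ((abs_pos.2 hx).trans_le this)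
  have h1 := φ.2 0 le_rfl
  have h2 : ∫ x : ℝ, (x : ℂ) ^ 0 * (φ : Test) x = ∫ _ : ℝ, (0 : ℂ) := by
    refine integral_congr_ae ?_
    filter_upwards [compl_mem_ae_iff.2 (measure_singleton (0 : ℝ))] with x hx
    simp [h0 x hx]
  rw [h2] at h1
  simp at h1

lemma size_dilate {ε : ℝ} (hε : 0 < ε) (φ : Test) : size (dilate ε φ) = ε * size φ := by
  have : (fun x : ℝ => |x|) '' Function.support (dilate ε φ) =
      ε • ((fun x : ℝ => |x|) '' Function.support φ) := by
    ext z
    simp only [Set.mem_image, Function.mem_support, Set.mem_smul_set, dilate_apply, smul_eq_mul]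
    constructor
    · rintro ⟨x, hx, rfl⟩
      refine ⟨_, ⟨ε⁻¹ * x, right_ne_zero_of_mul hx, rfl⟩, ?_⟩
      rw [abs_mul, abs_of_pos (inv_pos.2 hε)]
      field_simp
    · rintro ⟨_, ⟨x, hx, rfl⟩, rfl⟩
      refine ⟨ε * x, ?_, by rw [abs_mul, abs_of_pos hε]⟩
      have : (ε : ℂ) ≠ 0 := by exact_mod_cast hε.ne'
      rw [inv_mul_cancel_left₀ hε.ne']
      exact mul_ne_zero (inv_ne_zero this) hx
  rw [size, this, Real.sSup_smul_of_nonneg hε.le, smul_eq_mul, size]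

lemma size_scale {ε : ℝ} (hε : 0 < ε) (φ : A 0) : size (scale ε φ) = ε * size φ := by
  rw [scale, dif_pos hε]
  exact size_dilate hε φ

lemma iteratedDeriv_dilate (σ : ℝ) (χ : Test) (m : ℕ) (z : ℝ) :
    iteratedDeriv m (dilate σ χ) z = (σ⁻¹ : ℂ) ^ (m + 1) * iteratedDeriv m χ (σ⁻¹ * z) := by
  have h1 : ⇑(dilate σ χ) = fun x => (σ⁻¹ : ℂ) * (fun y => χ (σ⁻¹ * y)) x := rfl
  have h2 := congrFun (iteratedDeriv_comp_const_smul (n := m)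
    (χ.contDiff.of_le (by exact_mod_cast le_top)) σ⁻¹) z
  rw [h1, iteratedDeriv_const_mul_field]
  simp only [Complex.real_smul] at h2
  rw [h2]
  push_cast
  ring

/-- A profile `D(s, x)`, `s > 0`, of a model of the Dirac function. -/
structure DeltaModel where
  /-- The test function `D(s, ·)`; only `s > 0` matters. -/
  profile : ℝ → Test
  even : ∀ s > 0, ∀ x, profile s (-x) = profile s x
  integral_eq : ∀ s > 0, ∫ x, profile s x = 1
  integral_sq : ∀ s : ℝ, s > 0 → 1 / (s : ℂ) * ∫ x, profile s x ^ 2 = 1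
  /-- The functions `D(s, ·)` remain in a bounded subset of the space of test functions
  as `s → 0₊`: their supports lie in a common interval … -/
  support_bounded : ∃ l : ℝ, ∀ᶠ s in 𝓝[>] (0 : ℝ), ∀ x, profile s x ≠ 0 → |x| ≤ l
  /-- … and each derivative is uniformly bounded. -/
  deriv_bounded : ∀ k : ℕ, ∃ C : ℝ, ∀ᶠ s in 𝓝[>] (0 : ℝ), ∀ x, ‖iteratedDeriv k (profile s) x‖ ≤ C

namespace DeltaModel

/-- The function `D_σ(x) = σ⁻¹ D(σ, σ⁻¹ x)`. -/
def net (D : DeltaModel) (σ : ℝ) : Test := dilate σ (D.profile σ)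

/-- The representative `(φ, x) ↦ (u * D_{s(φ)})(x)`. -/
def rep (D : DeltaModel) (u : Distr) (φ : A 0) (x : ℝ) : ℂ := conv u (D.net (size φ)) x

lemma isModerate_rep (D : DeltaModel) (u : Distr) : IsModerate (D.rep u) := by
  refine ⟨fun φ => contDiff_conv u _, fun K hK p => ?_⟩
  obtain ⟨R, hR⟩ := hK.isBounded.subset_closedBall 0
  obtain ⟨l, hl⟩ := D.support_bounded
  obtain ⟨N, C, hC0, hC⟩ := u.bound (R + |l|)
  choose B hB using D.deriv_bounded
  refine ⟨N + p + 1, fun φ _ => ?_⟩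
  have hs := size_pos φ
  refine ⟨C * ((∑ k ∈ Finset.range (N + p + 1), |B k|) * (size φ)⁻¹ ^ (N + p + 1)), ?_⟩
  have hlim : Tendsto (fun ε : ℝ => ε * size φ) (𝓝[>] 0) (𝓝[>] 0) := by
    refine tendsto_nhdsWithin_iff.2 ⟨?_, ?_⟩
    · have : Tendsto (fun ε : ℝ => ε * size φ) (𝓝 0) (𝓝 (0 * size φ)) :=
        tendsto_id.mul_const _
      rw [zero_mul] at this
      exact this.mono_left nhdsWithin_le_nhds
    · filter_upwards [self_mem_nhdsWithin] with ε hε using mul_pos hε hs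
  have hall : ∀ᶠ s in 𝓝[>] (0 : ℝ), ∀ k ∈ Finset.range (N + p + 1), ∀ x,
      ‖iteratedDeriv k (D.profile s) x‖ ≤ B k :=
    (Finset.eventually_all _).2 fun k _ => hB k
  filter_upwards [hlim.eventually hl, hlim.eventually hall, hlim.eventually eventually_small,
    eventually_small] with ε h1 h2 h3 h4 x hx
  have e : D.rep u (scale ε φ) = conv u (D.net (ε * size φ)) := by
    funext y; rw [rep, size_scale h4.1]
  rw [e, iteratedDeriv_conv]
  set σ := ε * size φ with hσ
  have hinv : 1 ≤ σ⁻¹ := (one_le_inv₀ h3.1).2 h3.2.le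
  have hsum : 0 ≤ ∑ k ∈ Finset.range (N + p + 1), |B k| := Finset.sum_nonneg fun _ _ => abs_nonneg _
  have e2 : C * ((∑ k ∈ Finset.range (N + p + 1), |B k|) * (size φ)⁻¹ ^ (N + p + 1)) *
      ε⁻¹ ^ (N + p + 1) = C * ((∑ k ∈ Finset.range (N + p + 1), |B k|) * σ⁻¹ ^ (N + p + 1)) := by
    rw [hσ, mul_inv, mul_pow]; ring
  rw [e2]
  have hnet : ∀ z, D.net σ z ≠ 0 → |z| ≤ |l| := by
    intro z hz
    have := h1 _ (right_ne_zero_of_mul hz)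
    rw [abs_mul, abs_of_pos (inv_pos.2 h3.1)] at this
    calc |z| ≤ σ⁻¹ * |z| := le_mul_of_one_le_left (abs_nonneg _) hinv
      _ ≤ l := this
      _ ≤ |l| := le_abs_self _
  refine hC _ _ (by positivity) (fun y hy => ?_) (fun i hi y => ?_)
  · have h5 := Test.support_deriv_iterate _ hnet p _ hy
    have h6 : |x| ≤ R := by simpa using hR hx
    have h7 := abs_sub_abs_le_abs_sub y x
    rw [abs_sub_comm] at h7
    linarith
  · rw [iteratedDeriv_reflect, norm_mul, norm_pow, norm_neg, norm_one, one_pow, one_mul,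
      ← Test.coe_deriv_iterate, ← Function.iterate_add_apply, Test.coe_deriv_iterate, net,
      iteratedDeriv_dilate, norm_mul, norm_pow, norm_inv, Complex.norm_real, Real.norm_eq_abs,
      abs_of_pos h3.1, mul_comm]
    have hmem : i + p ∈ Finset.range (N + p + 1) := Finset.mem_range.2 (by omega)
    gcongr
    · exact ((h2 _ hmem _).trans (le_abs_self _)).trans
        (Finset.single_le_sum (f := fun k => |B k|) (fun _ _ => abs_nonneg _) hmem)

/-- The model in the Colombeau algebra of the distribution `u`, obtained by convolution
with `D`. -/
def model (D : DeltaModel) (u : Distr) : G := G.mk (D.rep u) (D.isModerate_rep u)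

/-- A real-valued test function, regarded as complex-valued. -/
def ofRealTest (f : 𝓓((⊤ : TopologicalSpace.Opens ℝ), ℝ)) : Test :=
  TestFunction.postcompCLM Complex.ofRealCLM f

@[simp] lemma ofRealTest_apply (f : 𝓓((⊤ : TopologicalSpace.Opens ℝ), ℝ)) (x : ℝ) :
    ofRealTest f x = (f x : ℂ) := rfl

/-- The profile `D(s, x) = f(x) + λ_s g(x)`, where `f` and `g` are real-valued even test functions
with disjoint supports, `∫ f = 1`, `∫ g = 0` and `λ_s² = (s - ∫ f²) / ∫ g²`. -/
def ofPair (f g : 𝓓((⊤ : TopologicalSpace.Opens ℝ), ℝ)) (lam : ℝ → ℂ)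
    (hf : ∀ x, f (-x) = f x) (hg : ∀ x, g (-x) = g x)
    (hfg : Disjoint (Function.support f) (Function.support g))
    (hf1 : ∫ x, f x = 1) (hg0 : ∫ x, g x = 0) (hgne : g ≠ 0)
    (hlam : ∀ s > 0, lam s ^ 2 = (((s - ∫ x, f x ^ 2) / ∫ x, g x ^ 2 : ℝ) : ℂ)) : DeltaModel where
  profile s := ofRealTest f + lam s • ofRealTest g
  even s _ x := by simp [hf, hg]
  integral_eq s _ := by
    have i1 : Integrable (fun x => (f x : ℂ)) :=
      (f.continuous.integrable_of_hasCompactSupport f.hasCompactSupport).ofReal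
    have i2 : Integrable (fun x => (g x : ℂ)) :=
      (g.continuous.integrable_of_hasCompactSupport g.hasCompactSupport).ofReal
    have e : ∀ x, (ofRealTest f + lam s • ofRealTest g) x = (f x : ℂ) + lam s * (g x : ℂ) :=
      fun x => by simp
    simp_rw [e]
    rw [integral_add i1 (i2.const_mul _), integral_const_mul, integral_complex_ofReal,
      integral_complex_ofReal, hf1, hg0]
    simp
  integral_sq s hs := by
    have sqc : ∀ f : 𝓓((⊤ : TopologicalSpace.Opens ℝ), ℝ), HasCompactSupport (fun x => f x ^ 2) :=
      fun f => f.hasCompactSupport.comp_left (g := fun y : ℝ => y ^ 2) (by simp)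
    have i : ∀ f : 𝓓((⊤ : TopologicalSpace.Opens ℝ), ℝ), Integrable (fun x => ((f x ^ 2 : ℝ) : ℂ)) :=
      fun f => ((f.continuous.pow 2).integrable_of_hasCompactSupport (sqc f)).ofReal
    have e : ∀ x, (ofRealTest f + lam s • ofRealTest g) x ^ 2 =
        ((f x ^ 2 : ℝ) : ℂ) + lam s ^ 2 * ((g x ^ 2 : ℝ) : ℂ) := by
      intro x
      have h0 : (f x : ℂ) * g x = 0 := by
        by_contra h
        exact Set.disjoint_left.1 hfg
          (show f x ≠ 0 from fun h' => h (by simp [h'])) (fun h' => h (by simp [h']))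
      have : (ofRealTest f + lam s • ofRealTest g) x = (f x : ℂ) + lam s * (g x : ℂ) := by simp
      rw [this]
      push_cast
      linear_combination 2 * lam s * h0
    have hpos : 0 < ∫ x, g x ^ 2 := by
      obtain ⟨x, hx⟩ := DFunLike.ne_iff.1 hgne
      exact (g.continuous.pow 2).integral_pos_of_hasCompactSupport_nonneg_nonzero (sqc g)
        (fun _ => sq_nonneg _) (x := x) (pow_ne_zero 2 hx)
    simp_rw [e]
    rw [integral_add (i f) ((i g).const_mul _), integral_const_mul, integral_complex_ofReal,
      integral_complex_ofReal, hlam s hs]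
    norm_cast
    have := hpos.ne'
    have := hs.ne'
    field_simp
    ring
  support_bounded := by
    obtain ⟨l₁, h₁⟩ := (ofRealTest f).exists_support
    obtain ⟨l₂, h₂⟩ := (ofRealTest g).exists_support
    refine ⟨max l₁ l₂, ?_⟩
    filter_upwards with s x hx
    by_contra h
    rw [not_le, max_lt_iff] at h
    apply hx
    have e₁ : ofRealTest f x = 0 := by by_contra h'; exact absurd (h₁ x h') (not_le.2 h.1)
    have e₂ : ofRealTest g x = 0 := by by_contra h'; exact absurd (h₂ x h') (not_le.2 h.2)
    change ofRealTest f x + lam s • ofRealTest g x = 0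
    simp [e₁, e₂]
  deriv_bounded k := by
    obtain ⟨C₁, -, h₁⟩ := (ofRealTest f).exists_bound k
    obtain ⟨C₂, h0, h₂⟩ := (ofRealTest g).exists_bound k
    set a := ∫ x, f x ^ 2
    set b := ∫ x, g x ^ 2
    refine ⟨C₁ + (1 + (1 + |a|) / |b|) * C₂, ?_⟩
    filter_upwards [eventually_small] with s ⟨hs, hs1⟩ x
    have hl : ‖lam s‖ ≤ 1 + (1 + |a|) / |b| := by
      have h3 : ‖lam s‖ ^ 2 ≤ (1 + |a|) / |b| := by
        rw [← norm_pow, hlam s hs, Complex.norm_real, Real.norm_eq_abs, abs_div]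
        gcongr
        refine (abs_sub _ _).trans ?_
        rw [abs_of_pos hs]
        gcongr
      nlinarith [sq_nonneg (‖lam s‖ - 1), norm_nonneg (lam s)]
    have e : ⇑(ofRealTest f + lam s • ofRealTest g) =
        ⇑(ofRealTest f) + lam s • ⇑(ofRealTest g) := rfl
    have c₂ : ContDiffAt ℝ k (lam s • ⇑(ofRealTest g)) x :=
      (contDiffAt_nat (ofRealTest g).contDiff k x).const_smul (lam s)
    rw [e, iteratedDeriv_add (contDiffAt_nat (ofRealTest f).contDiff k x) c₂,
      iteratedDeriv_const_smul_field]
    refine norm_add_le_of_le (h₁ x) ?_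
    rw [norm_smul]
    exact mul_le_mul hl (h₂ x) (norm_nonneg _) (by positivity)

end DeltaModel

end

end Colombeau

open scoped Distributions ContDiff Topology Pointwise
open Filter MeasureTheory

namespace Colombeau

noncomputable section

/-! ### Convolution with locally integrable functions -/

/-! Let `σ = s(φ)` and `d = D(σ, ·)`. Each of the four generalized functions has a representative of
the form `σ⁻² f(x/σ)`, with `f` built from `d` at unit scale, supported in a fixed interval and
bounded as `σ → 0`. Substituting `x = σt` turns the pairing with `ψ` into `σ⁻¹ ∫ f(t) ψ(σt) dt`, and
Taylor's formula gives `σ⁻¹ ψ(0) ∫ f + ψ'(0) ∫ t f + O(σ)`. So association with `c δ` reduces to two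
moments, `∫ f = c σ` and `∫ t f = 0` (`tendsto_of_moments`, `assoc_of_moments`). For `D` and `D²`
one takes `f = σ d` and `f = d²`; evenness removes the first moment, and `∫ d² = σ` is the
normalization of the model.

For the first cross product, dilating the logarithms creates terms in `ln σ`. These cancel between
the two products, which is why the combination is homogeneous although neither product is
(`crossMinus_dilate`). Write `H = θ * d` and `P = (-(ln x₋) * d' + d) H - ((ln x₊) * d) d`, a
compactly supported function. Since `H' = d`, one has `P' = f + d² - d (ln|x| * d')`. The last term
is odd, so integration gives `∫ f = -∫ d² = -σ`.

Integrating `(tP)'` gives `∫ t f = J - ∫ P`, with `J = ∫ t d (ln|x| * d')`. Formally `J` is the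
double integral of `t d(t) d(s) / (t - s)`, which symmetrizes to `(∫ d)² / 2 = 1/2`; the proof in
`integral_mulX_mul_conv_lnAbs_deriv` avoids the singular kernel. Also `∫ P = 1/2`, because evenness
of `d` makes the logarithmic contributions cancel. Hence the first moment vanishes. The second cross
product is the mirror image of the first. -/

lemma Test.ext_apply {χ ψ : Test} (h : ∀ x, χ x = ψ x) : χ = ψ := DFunLike.ext _ _ h

lemma Test.integrable (χ : Test) : Integrable χ :=
  χ.continuous.integrable_of_hasCompactSupport χ.hasCompactSupport

lemma Test.hasDerivAt (χ : Test) (x : ℝ) : HasDerivAt χ (χ.deriv x) x := by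
  rw [Test.coe_deriv]
  exact ((χ.contDiff.differentiable (by simp)) x).hasDerivAt

lemma Test.integrable_mul (χ : Test) {f : ℝ → ℂ} (hf : LocallyIntegrable f) :
    Integrable (fun x => χ x * f x) := by
  simpa using hf.integrable_smul_left_of_hasCompactSupport χ.continuous χ.hasCompactSupport

lemma integrable_conv (χ : Test) (x : ℝ) {f : ℝ → ℂ} (hf : LocallyIntegrable f) :
    Integrable (fun y => χ (x - y) * f y) :=
  (reflect χ x).integrable_mul hf

lemma Distr.ofFun_apply {f : ℝ → ℂ} (hf : LocallyIntegrable f) (ψ : Test) :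
    Distr.ofFun f ψ = ∫ x, ψ x * f x := by
  rw [Distr.ofFun, TestFunction.integralAgainstBilinCLM_eq_integral (hf.locallyIntegrableOn _)]
  rfl

lemma conv_ofFun {f : ℝ → ℂ} (hf : LocallyIntegrable f) (χ : Test) (x : ℝ) :
    conv (Distr.ofFun f) χ x = ∫ y, χ (x - y) * f y :=
  Distr.ofFun_apply hf _

lemma Test.deriv_reflect (χ : Test) (x : ℝ) : (reflect χ x).deriv = -reflect χ.deriv x := by
  refine Test.ext_apply fun y => ?_
  have h := iteratedDeriv_reflect χ x 1 y
  rw [Test.coe_deriv]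
  simp only [iteratedDeriv_one, pow_one] at h
  rw [h, ← Test.coe_deriv]
  change _ = -(χ.deriv (x - y))
  ring

lemma Test.deriv_smul (c : ℂ) (χ : Test) : (c • χ).deriv = c • χ.deriv := by
  simp [Test.deriv]

lemma Test.deriv_neg (χ : Test) : (-χ).deriv = -χ.deriv := by
  simp [Test.deriv]

lemma Test.deriv_dilate (σ : ℝ) (χ : Test) :
    (dilate σ χ).deriv = (σ⁻¹ : ℂ) • dilate σ χ.deriv := by
  refine Test.ext_apply fun y => ?_
  have h := iteratedDeriv_dilate σ χ 1 y
  simp only [iteratedDeriv_one] at h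
  rw [Test.coe_deriv, h, ← Test.coe_deriv]
  change _ = (σ⁻¹ : ℂ) * ((σ⁻¹ : ℂ) * χ.deriv (σ⁻¹ * y))
  ring

lemma conv_smul (u : Distr) (c : ℂ) (χ : Test) (x : ℝ) :
    conv u (c • χ) x = c * conv u χ x := by
  have : reflect (c • χ) x = c • reflect χ x := rfl
  simp [conv, this]

lemma conv_neg (u : Distr) (χ : Test) (x : ℝ) : conv u (-χ) x = -conv u χ x := by
  have : reflect (-χ) x = -reflect χ x := rfl
  simp [conv, this]

lemma conv_add (u : Distr) (χ ψ : Test) (x : ℝ) :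
    conv u (χ + ψ) x = conv u χ x + conv u ψ x := by
  have : reflect (χ + ψ) x = reflect χ x + reflect ψ x := rfl
  simp [conv, this]

/-- The sign in the distributional derivative cancels the sign from differentiating `y ↦ χ (x - y)`.
-/
lemma conv_deriv (u : Distr) (χ : Test) (x : ℝ) : conv u.deriv χ x = conv u χ.deriv x := by
  change -(u (reflect χ x).deriv) = _
  rw [Test.deriv_reflect]
  simp [conv]

@[simp] lemma conv_delta (χ : Test) (x : ℝ) : conv delta χ x = χ x := by
  change χ (x - 0) = χ x
  rw [sub_zero]

lemma continuous_conv (u : Distr) (χ : Test) : Continuous (conv u χ) :=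
  (contDiff_conv u χ).continuous

/-- Convolutions of a distribution with a bounded set of test functions are locally bounded. -/
lemma conv_bounded (u : Distr) {ι : Type*} {F : Filter ι} {d : ι → Test} {l : ℝ}
    (hl : ∀ᶠ i in F, ∀ x, d i x ≠ 0 → |x| ≤ l)
    (hB : ∀ k : ℕ, ∃ C : ℝ, ∀ᶠ i in F, ∀ x, ‖iteratedDeriv k (d i) x‖ ≤ C) (m : ℕ) (R : ℝ) :
    ∃ C : ℝ, ∀ᶠ i in F, ∀ x, |x| ≤ R → ‖conv u (Test.deriv^[m] (d i)) x‖ ≤ C := by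
  obtain ⟨N, C, hC0, hC⟩ := u.bound (R + l)
  choose B hB using hB
  refine ⟨C * ∑ k ∈ Finset.range (N + m + 1), |B k|, ?_⟩
  have hall : ∀ᶠ i in F, ∀ k ∈ Finset.range (N + m + 1), ∀ x,
      ‖iteratedDeriv k (d i) x‖ ≤ B k := (Finset.eventually_all _).2 fun k _ => hB k
  filter_upwards [hl, hall] with i h1 h2 x hx
  refine hC _ _ (Finset.sum_nonneg fun _ _ => abs_nonneg _) (fun y hy => ?_) (fun j hj y => ?_)
  · have h5 := Test.support_deriv_iterate _ h1 m _ hy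
    have h7 := abs_sub_abs_le_abs_sub y x
    rw [abs_sub_comm] at h7
    linarith
  · rw [iteratedDeriv_reflect, norm_mul, norm_pow, norm_neg, norm_one, one_pow, one_mul,
      ← Test.coe_deriv_iterate, ← Function.iterate_add_apply, Test.coe_deriv_iterate]
    have hmem : j + m ∈ Finset.range (N + m + 1) := Finset.mem_range.2 (by omega)
    exact ((h2 _ hmem _).trans (le_abs_self _)).trans
        (Finset.single_le_sum (f := fun k => |B k|) (fun _ _ => abs_nonneg _) hmem)

/-! ### Homogeneity of the step functions and logarithms under dilation -/

/-- Rescaling the variable in the convolution of a function with a dilated test function. -/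
lemma conv_ofFun_dilate {f : ℝ → ℂ} (hf : LocallyIntegrable f) (χ : Test) {σ : ℝ} (hσ : 0 < σ)
    (t : ℝ) : conv (Distr.ofFun f) (dilate σ χ) (σ * t) = ∫ y, χ (t - y) * f (σ * y) := by
  have hc : (σ : ℂ) ≠ 0 := by exact_mod_cast hσ.ne'
  rw [conv_ofFun hf]
  have h := Measure.integral_comp_mul_left (fun y => dilate σ χ (σ * t - y) * f y) σ
  have e : ∀ y : ℝ, dilate σ χ (σ * t - σ * y) * f (σ * y) =
      (σ⁻¹ : ℂ) * (χ (t - y) * f (σ * y)) := by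
    intro y
    rw [dilate_apply, ← mul_sub, inv_mul_cancel_left₀ hσ.ne', mul_assoc]
  simp_rw [e] at h
  rw [integral_const_mul, abs_of_pos (inv_pos.2 hσ), Complex.real_smul] at h
  push_cast at h
  exact (mul_left_cancel₀ (inv_ne_zero hc) h).symm

lemma conv_heaviside_dilate (χ : Test) {σ : ℝ} (hσ : 0 < σ) (t : ℝ) :
    conv heaviside (dilate σ χ) (σ * t) = conv heaviside χ t := by
  rw [heaviside, conv_ofFun_dilate locallyIntegrable_heavisideFun χ hσ,
    conv_ofFun locallyIntegrable_heavisideFun]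
  simp [heavisideFun, hσ]

/-- From `ln (σ y) = ln σ + ln y` for `y > 0`. The term with `ln σ` is the defect of homogeneity
that has to cancel in the cross products. -/
lemma conv_lnPlus_dilate (χ : Test) {σ : ℝ} (hσ : 0 < σ) (t : ℝ) :
    conv lnPlus (dilate σ χ) (σ * t) = conv lnPlus χ t + Real.log σ * conv heaviside χ t := by
  rw [lnPlus, heaviside, conv_ofFun_dilate locallyIntegrable_lnPlusFun χ hσ,
    conv_ofFun locallyIntegrable_heavisideFun, conv_ofFun locallyIntegrable_lnPlusFun,
    ← integral_const_mul, ← integral_add (integrable_conv χ t locallyIntegrable_lnPlusFun)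
    ((integrable_conv χ t locallyIntegrable_heavisideFun).const_mul _)]
  refine integral_congr_ae (.of_forall fun y => ?_)
  by_cases hy : 0 < y
  · simp only [lnPlusFun, heavisideFun, mul_pos_iff_of_pos_left hσ, hy, if_true,
      Real.log_mul hσ.ne' hy.ne']
    push_cast
    ring
  · simp [lnPlusFun, heavisideFun, mul_pos_iff_of_pos_left hσ, hy]

lemma conv_lnMinus_dilate (χ : Test) {σ : ℝ} (hσ : 0 < σ) (t : ℝ) :
    conv lnMinus (dilate σ χ) (σ * t) =
      conv lnMinus χ t + Real.log σ * conv heavisideRef χ t := by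
  rw [lnMinus, heavisideRef, conv_ofFun_dilate locallyIntegrable_lnMinusFun χ hσ,
    conv_ofFun locallyIntegrable_heavisideRefFun, conv_ofFun locallyIntegrable_lnMinusFun,
    ← integral_const_mul, ← integral_add (integrable_conv χ t locallyIntegrable_lnMinusFun)
    ((integrable_conv χ t locallyIntegrable_heavisideRefFun).const_mul _)]
  refine integral_congr_ae (.of_forall fun y => ?_)
  have e : σ * y < 0 ↔ y < 0 := by simp [mul_neg_iff, hσ, hσ.not_gt]
  by_cases hy : y < 0
  · simp only [lnMinusFun, heavisideRefFun, e, hy, if_true, ← mul_neg,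
      Real.log_mul hσ.ne' (neg_pos.2 hy).ne']
    push_cast
    ring
  · simp [lnMinusFun, heavisideRefFun, e, hy]

/-! ### Reflection -/

lemma conv_ofFun_reflect {f g : ℝ → ℂ} (hf : LocallyIntegrable f) (hg : LocallyIntegrable g)
    (h : ∀ y, g y = f (-y)) (χ : Test) (x : ℝ) :
    conv (Distr.ofFun f) χ (-x) = conv (Distr.ofFun g) (reflect χ 0) x := by
  rw [conv_ofFun hf, conv_ofFun hg, ← integral_neg_eq_self]
  refine integral_congr_ae (.of_forall fun y => ?_)
  simp only [reflect_apply, h]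
  congr 2
  ring

lemma conv_heaviside_neg (χ : Test) (x : ℝ) :
    conv heaviside χ (-x) = conv heavisideRef (reflect χ 0) x :=
  conv_ofFun_reflect locallyIntegrable_heavisideFun locallyIntegrable_heavisideRefFun
    (fun y => by simp [heavisideFun, heavisideRefFun]) χ x

lemma conv_lnPlus_neg (χ : Test) (x : ℝ) :
    conv lnPlus χ (-x) = conv lnMinus (reflect χ 0) x :=
  conv_ofFun_reflect locallyIntegrable_lnPlusFun locallyIntegrable_lnMinusFun
    (fun y => by simp [lnPlusFun, lnMinusFun]) χ x

lemma conv_lnMinus_neg (χ : Test) (x : ℝ) :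
    conv lnMinus χ (-x) = conv lnPlus (reflect χ 0) x :=
  conv_ofFun_reflect locallyIntegrable_lnMinusFun locallyIntegrable_lnPlusFun
    (fun y => by simp [lnPlusFun, lnMinusFun]) χ x

/-- The distribution `ln |x|`. -/
def lnAbs : Distr := Distr.ofFun fun x => (Real.log x : ℂ)

lemma conv_lnAbs_neg (χ : Test) (x : ℝ) :
    conv lnAbs χ (-x) = conv lnAbs (reflect χ 0) x :=
  conv_ofFun_reflect locallyIntegrable_log locallyIntegrable_log (fun y => by simp) χ x

lemma conv_lnMinus_add_conv_lnPlus (χ : Test) (x : ℝ) :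
    conv lnMinus χ x + conv lnPlus χ x = conv lnAbs χ x := by
  rw [lnMinus, lnPlus, lnAbs, conv_ofFun locallyIntegrable_lnMinusFun,
    conv_ofFun locallyIntegrable_lnPlusFun, conv_ofFun locallyIntegrable_log,
    ← integral_add (integrable_conv χ x locallyIntegrable_lnMinusFun)
      (integrable_conv χ x locallyIntegrable_lnPlusFun)]
  refine integral_congr_ae (.of_forall fun y => ?_)
  rcases lt_trichotomy y 0 with hy | rfl | hy
  · simp [lnMinusFun, lnPlusFun, hy, hy.not_gt]
  · simp [lnMinusFun, lnPlusFun]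
  · simp [lnMinusFun, lnPlusFun, hy, hy.not_gt]

/-- The two step functions add up to `1` almost everywhere. -/
lemma conv_heaviside_add_conv_heavisideRef (χ : Test) (x : ℝ) :
    conv heaviside χ x + conv heavisideRef χ x = ∫ y, χ y := by
  rw [heaviside, heavisideRef, conv_ofFun locallyIntegrable_heavisideFun,
    conv_ofFun locallyIntegrable_heavisideRefFun,
    ← integral_add (integrable_conv χ x locallyIntegrable_heavisideFun)
      (integrable_conv χ x locallyIntegrable_heavisideRefFun),
    ← integral_sub_left_eq_self χ volume x]
  refine integral_congr_ae ?_
  -- Both step functions take the value `0` at the origin, so that point is discarded.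
  filter_upwards [compl_mem_ae_iff.2 (measure_singleton (0 : ℝ))] with y hy
  rcases lt_or_gt_of_ne hy with hy | hy
  · simp [heavisideFun, heavisideRefFun, hy, hy.not_gt]
  · simp [heavisideFun, heavisideRefFun, hy, hy.not_gt]

lemma Test.integral_deriv (χ : Test) : ∫ x, χ.deriv x = 0 :=
  integral_eq_zero_of_hasDerivAt_of_integrable χ.hasDerivAt χ.deriv.integrable χ.integrable

/-- This is `θ' = δ`, by the fundamental theorem of calculus on the half-line. -/
lemma conv_heaviside_deriv (χ : Test) (x : ℝ) : conv heaviside χ.deriv x = χ x := by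
  rw [heaviside, conv_ofFun locallyIntegrable_heavisideFun]
  have e : (fun y => χ.deriv (x - y) * heavisideFun y) =
      (Set.Ioi (0 : ℝ)).indicator (fun y => -_root_.deriv (reflect χ x) y) := by
    funext y
    rw [← Test.coe_deriv, Test.deriv_reflect]
    simp only [Set.indicator, heavisideFun, Set.mem_Ioi]
    split_ifs
    · change _ = - -(χ.deriv (x - y))
      ring
    · ring
  rw [e, integral_indicator measurableSet_Ioi, integral_neg,
    HasCompactSupport.integral_Ioi_deriv_eq ((reflect χ x).contDiff.of_le (by simp))
      (reflect χ x).hasCompactSupport]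
  simp

lemma conv_heavisideRef_deriv (χ : Test) (x : ℝ) : conv heavisideRef χ.deriv x = -χ x := by
  have h := conv_heaviside_add_conv_heavisideRef χ.deriv x
  rw [χ.integral_deriv, conv_heaviside_deriv] at h
  linear_combination h

/-! ### Supports -/

lemma conv_heaviside_eq_zero {χ : Test} {l : ℝ} (hl : ∀ x, χ x ≠ 0 → |x| ≤ l) {x : ℝ}
    (hx : x < -l) : conv heaviside χ x = 0 := by
  rw [heaviside, conv_ofFun locallyIntegrable_heavisideFun]
  refine integral_eq_zero_of_ae (.of_forall fun y => ?_)
  by_cases hy : 0 < y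
  · have : χ (x - y) = 0 := by
      by_contra h
      have := (abs_le.1 (hl _ h)).1
      linarith
    simp [this]
  · simp [heavisideFun, hy]

lemma conv_lnMinus_eq_zero {χ : Test} {l : ℝ} (hl : ∀ x, χ x ≠ 0 → |x| ≤ l) {x : ℝ}
    (hx : l < x) : conv lnMinus χ x = 0 := by
  rw [lnMinus, conv_ofFun locallyIntegrable_lnMinusFun]
  refine integral_eq_zero_of_ae (.of_forall fun y => ?_)
  by_cases hy : y < 0
  · have : χ (x - y) = 0 := by
      by_contra h
      have := (abs_le.1 (hl _ h)).2
      linarith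
    simp [this]
  · simp [lnMinusFun, hy]

/-! ### The logarithmic kernel -/

/-- The test function `x ↦ x χ(x)`. -/
def Test.mulX (χ : Test) : Test :=
  Test.of (fun x => (x : ℂ) * χ x) (Complex.ofRealCLM.contDiff.mul χ.contDiff)
    χ.hasCompactSupport.mul_left

@[simp] lemma Test.mulX_apply (χ : Test) (x : ℝ) : χ.mulX x = x * χ x := rfl

lemma Test.deriv_mulX (χ : Test) : χ.mulX.deriv = χ + χ.deriv.mulX := by
  refine Test.ext_apply fun x => ?_
  rw [Test.coe_deriv]
  have h := (Complex.ofRealCLM.hasDerivAt (x := x)).mul (χ.hasDerivAt x)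
  simp only [Complex.ofRealCLM_apply, Complex.ofReal_one, one_mul] at h
  exact h.deriv

/-- Where the integrand is nonzero, `y = x - (x - y)` stays in a fixed compact interval. There the
integrand is dominated by a constant times a product of integrable functions of `x` and of `y`. This
justifies Fubini's theorem for the logarithmic kernel. -/
lemma integrable_mul_log_prod (χ ψ : Test) :
    Integrable (Function.uncurry fun x y : ℝ => χ x * (ψ (x - y) * (Real.log y : ℂ)))
      (volume.prod volume) := by
  obtain ⟨l, hl⟩ := χ.exists_support
  obtain ⟨m, hm⟩ := ψ.exists_support
  obtain ⟨C, hC0, hC⟩ := ψ.exists_bound 0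
  have h1 : IntegrableOn (fun y : ℝ => (Real.log y : ℂ)) (Set.Icc (-(l + m)) (l + m)) :=
    locallyIntegrable_log.integrableOn_isCompact isCompact_Icc
  have h2 := χ.integrable.mul_prod (h1.integrable_indicator measurableSet_Icc)
  refine (h2.norm.const_mul C).mono' ?_ (.of_forall fun z => ?_)
  · have h3 : Measurable fun y : ℝ => (Real.log y : ℂ) :=
      Complex.measurable_ofReal.comp Real.measurable_log
    exact ((χ.continuous.measurable.comp measurable_fst).mul
      ((ψ.continuous.measurable.comp (measurable_fst.sub measurable_snd)).mul
        (h3.comp measurable_snd))).aestronglyMeasurable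
  · obtain ⟨x, y⟩ := z
    simp only [Function.uncurry_apply_pair]
    by_cases hx : χ x = 0
    · simp [hx]
    by_cases hy : ψ (x - y) = 0
    · simp only [hy, zero_mul, mul_zero, norm_zero]
      positivity
    have h4 : y ∈ Set.Icc (-(l + m)) (l + m) := by
      have h5 := abs_le.1 (hl x hx)
      have h6 := abs_le.1 (hm _ hy)
      constructor <;> linarith
    rw [Set.indicator_of_mem h4, norm_mul, norm_mul, norm_mul]
    have h7 : ‖ψ (x - y)‖ ≤ C := by simpa using hC (x - y)
    calc ‖χ x‖ * (‖ψ (x - y)‖ * ‖(Real.log y : ℂ)‖)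
        ≤ ‖χ x‖ * (C * ‖(Real.log y : ℂ)‖) := by gcongr
      _ = C * (‖χ x‖ * ‖(Real.log y : ℂ)‖) := by ring

lemma integral_mul_conv_lnAbs (χ ψ : Test) :
    ∫ x, χ x * conv lnAbs ψ x = ∫ y : ℝ, ∫ x : ℝ, χ x * (ψ (x - y) * (Real.log y : ℂ)) := by
  rw [← integral_integral_swap (integrable_mul_log_prod χ ψ)]
  refine integral_congr_ae (.of_forall fun x => ?_)
  simp only
  rw [lnAbs, conv_ofFun locallyIntegrable_log, integral_const_mul]

/-- The kernel `ln |x - y|` is symmetric. -/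
lemma integral_mul_conv_lnAbs_comm (χ ψ : Test) :
    ∫ x, χ x * conv lnAbs ψ x = ∫ x, ψ x * conv lnAbs χ x := by
  rw [integral_mul_conv_lnAbs, integral_mul_conv_lnAbs, ← integral_neg_eq_self]
  refine integral_congr_ae (.of_forall fun y => ?_)
  simp only
  -- After `y ↦ -y`, the shift `x ↦ x - y` exchanges the arguments of the two test functions;
  -- evenness of `log |y|` does the rest.
  rw [← integral_sub_right_eq_self _ y]
  refine integral_congr_ae (.of_forall fun x => ?_)
  simp only [sub_neg_eq_add, sub_add_cancel, Real.log_neg_eq_log]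
  ring

/-- `ln |x| + 1` is the distributional derivative of `x ln |x|`. -/
lemma integral_deriv_mul_mul_log (χ : Test) :
    ∫ y : ℝ, χ.deriv y * (y * Real.log y : ℂ) = -∫ y : ℝ, χ y * (Real.log y + 1 : ℂ) := by
  have hli : LocallyIntegrable fun y : ℝ => (Real.log y + 1 : ℂ) :=
    locallyIntegrable_log.add (locallyIntegrable_const 1)
  have hcont : Continuous fun y : ℝ => (y * Real.log y : ℂ) := by
    have := Complex.continuous_ofReal.comp Real.continuous_mul_log
    simpa [Function.comp_def] using this
  have i1 := χ.integrable_mul hli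
  have i2 := χ.deriv.integrable_mul hcont.locallyIntegrable
  obtain ⟨l, hl⟩ := χ.exists_support
  have hl' := χ.support_deriv hl
  have h0 : ∀ y, y ∉ Set.Ioc (-(|l| + 1)) (|l| + 1) → χ y = 0 := by
    intro y hy
    by_contra h
    have h1 := abs_le.1 ((hl y h).trans (le_abs_self l))
    exact hy ⟨by linarith, by linarith⟩
  have h0' : ∀ y, y ∉ Set.Ioc (-(|l| + 1)) (|l| + 1) → χ.deriv y = 0 := by
    intro y hy
    by_contra h
    have h1 := abs_le.1 ((hl' y h).trans (le_abs_self l))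
    exact hy ⟨by linarith, by linarith⟩
  -- The right endpoint belongs to the half-open interval, so `h0` does not cover it.
  have e1 : χ (|l| + 1) = 0 := by
    by_contra h
    have h1 := abs_le.1 ((hl _ h).trans (le_abs_self l))
    linarith
  have e2 : χ (-(|l| + 1)) = 0 := h0 _ (by simp)
  -- `y log |y|` is continuous everywhere but differentiable only away from `0`, hence the
  -- exceptional set `{0}`.
  have key := integral_eq_of_hasDerivAt_off_countable
    (fun y : ℝ => χ y * (y * Real.log y : ℂ))
    (fun y : ℝ => χ.deriv y * (y * Real.log y : ℂ) + χ y * (Real.log y + 1 : ℂ))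
    (a := -(|l| + 1)) (b := |l| + 1) (s := {0}) (Set.countable_singleton 0)
    (χ.continuous.mul hcont).continuousOn (fun y hy => by
      refine (χ.hasDerivAt y).mul ?_
      have := (Real.hasDerivAt_mul_log (x := y) hy.2).ofReal_comp
      simpa using this) ((i2.add i1).intervalIntegrable)
  simp only [e1, e2, zero_mul, sub_zero] at key
  rw [intervalIntegral.integral_of_le (by linarith [abs_nonneg l]),
    setIntegral_eq_integral_of_forall_compl_eq_zero (fun y hy => by simp [h0 y hy, h0' y hy]),
    integral_add i2 i1] at key
  linear_combination key

/-- The operator `x ∂` applied to a convolution with `ln |x|`. -/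
lemma mul_conv_lnAbs_deriv (χ : Test) (t : ℝ) :
    t * conv lnAbs χ.deriv t = conv lnAbs χ.mulX.deriv t + ∫ y, χ y := by
  -- Splitting `t = (t - y) + y` under the integral, the part with `t - y` is a convolution with `x
  -- χ'`. The part with `y` is integrated by parts here, and the `1` in `log |y| + 1` produces `∫
  -- χ`.
  have h := integral_deriv_mul_mul_log (reflect χ t)
  have hd : ∀ y, (reflect χ t).deriv y = -χ.deriv (t - y) := fun y => by
    rw [Test.deriv_reflect]; rfl
  have i0 := integrable_conv χ t locallyIntegrable_log
  have i1 : Integrable fun y => χ (t - y) := (reflect χ t).integrable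
  have i2 := integrable_conv χ.deriv.mulX t locallyIntegrable_log
  have i3 : Integrable fun y : ℝ => χ.deriv (t - y) * (y * Real.log y : ℂ) := by
    refine integrable_conv χ.deriv t (Continuous.locallyIntegrable ?_)
    have := Complex.continuous_ofReal.comp Real.continuous_mul_log
    simpa [Function.comp_def] using this
  simp only [hd, neg_mul, integral_neg, reflect_apply, mul_add, mul_one, neg_inj] at h
  rw [integral_add i0 i1, integral_sub_left_eq_self χ volume t] at h
  rw [Test.deriv_mulX, conv_add]
  simp only [lnAbs, conv_ofFun locallyIntegrable_log]
  rw [add_right_comm, ← h, ← integral_add i3 i2, ← integral_const_mul]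
  refine integral_congr_ae (.of_forall fun y => ?_)
  simp only [Test.mulX_apply]
  push_cast
  ring

lemma integrable_test_mul_conv (χ ψ : Test) (u : Distr) : Integrable fun x => χ x * conv u ψ x :=
  χ.integrable_mul (continuous_conv u ψ).locallyIntegrable

/-- Call the integral `J`. Commuting `x` past the convolution gives `J = ∫ χ (ln|x| * (xχ)') + (∫
χ)²`. By symmetry of the kernel and integration by parts, the first term on the right is `-J`. -/
lemma integral_mulX_mul_conv_lnAbs_deriv (χ : Test) :
    ∫ t : ℝ, χ.mulX t * conv lnAbs χ.deriv t = (∫ y, χ y) ^ 2 / 2 := by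
  have h1 : ∫ t : ℝ, χ.mulX t * conv lnAbs χ.deriv t =
      (∫ t, χ t * conv lnAbs χ.mulX.deriv t) + (∫ y, χ y) ^ 2 := by
    rw [sq, ← integral_mul_const, ← integral_add (integrable_test_mul_conv _ _ _)
      (χ.integrable.mul_const _)]
    refine integral_congr_ae (.of_forall fun t => ?_)
    simp only [Test.mulX_apply]
    linear_combination χ t * mul_conv_lnAbs_deriv χ t
  have h2 : (∫ t, χ.mulX.deriv t * conv lnAbs χ t) + ∫ t, χ.mulX t * conv lnAbs χ.deriv t = 0 := by
    rw [← integral_add (integrable_test_mul_conv _ _ _) (integrable_test_mul_conv _ _ _)]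
    exact integral_eq_zero_of_hasDerivAt_of_integrable
      (fun x => (χ.mulX.hasDerivAt x).mul (conv_hasDerivAt lnAbs χ x))
      ((integrable_test_mul_conv _ _ _).add (integrable_test_mul_conv _ _ _))
      (integrable_test_mul_conv _ _ _)
  rw [integral_mul_conv_lnAbs_comm χ] at h1
  linear_combination (h1 + h2) / 2

/-! ### Moments of the products at unit scale -/

lemma integrable_of_support {f : ℝ → ℂ} (hf : Continuous f) {l : ℝ}
    (h : ∀ x, f x ≠ 0 → |x| ≤ l) : Integrable f :=
  hf.integrable_of_hasCompactSupport
    (HasCompactSupport.of_support_subset_isCompact (isCompact_Icc (a := -l) (b := l))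
      fun x hx => abs_le.1 (h x hx))

lemma integrable_fun_sub {f g : ℝ → ℂ} (hf : Integrable f) (hg : Integrable g) :
    Integrable fun x => f x - g x := hf.sub hg

lemma integral_eq_zero_of_odd {f : ℝ → ℂ} (h : ∀ x, f (-x) = -f x) : ∫ x, f x = 0 := by
  have h1 := integral_neg_eq_self f volume
  simp only [h, integral_neg] at h1
  linear_combination (-1 / 2 : ℂ) * h1

lemma reflect_of_even {d : Test} (hd : ∀ x, d (-x) = d x) : reflect d 0 = d :=
  Test.ext_apply fun x => by simp [hd]

lemma reflect_deriv_of_even {d : Test} (hd : ∀ x, d (-x) = d x) : reflect d.deriv 0 = -d.deriv := by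
  have h := Test.deriv_reflect d 0
  rw [reflect_of_even hd] at h
  rw [h, neg_neg, ← h]

lemma reflect_deriv_deriv_of_even {d : Test} (hd : ∀ x, d (-x) = d x) : reflect d.deriv.deriv 0 = d.deriv.deriv := by
  have h := Test.deriv_reflect d.deriv 0
  rw [reflect_deriv_of_even hd, Test.deriv_neg] at h
  exact (neg_injective h).symm

lemma deriv_neg_of_even {d : Test} (hd : ∀ x, d (-x) = d x) (x : ℝ) : d.deriv (-x) = -d.deriv x := by
  have h := DFunLike.congr_fun (reflect_deriv_of_even hd) x
  simpa using h

/-- For even `d`, the reflection `x ↦ -x` exchanges `θ` with its mirror image, so both give the same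
integral; together they give `(∫ d)² = 1`. -/
lemma integral_mul_conv_heaviside {d : Test} (hd : ∀ x, d (-x) = d x)
    (h1 : ∫ x, d x = 1) :
    ∫ x, d x * conv heaviside d x = 1 / 2 := by
  have h := integral_neg_eq_self (fun x => d x * conv heaviside d x) volume
  have h2 : (∫ x, d x * conv heaviside d x) + ∫ x, d x * conv heavisideRef d x = 1 := by
    rw [← integral_add (integrable_test_mul_conv _ _ _) (integrable_test_mul_conv _ _ _), ← h1]
    refine integral_congr_ae (.of_forall fun x => ?_)
    have := conv_heaviside_add_conv_heavisideRef d x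
    rw [h1] at this
    linear_combination d x * this
  simp only [conv_heaviside_neg, hd, reflect_of_even hd] at h
  linear_combination (h2 - h) / 2

lemma integral_mul_conv_lnPlus_eq {d : Test} (hd : ∀ x, d (-x) = d x) :
    ∫ x, d x * conv lnPlus d x = ∫ x, d x * conv lnMinus d x := by
  rw [← integral_neg_eq_self]
  simp only [conv_lnPlus_neg, hd, reflect_of_even hd]

/-- An even function times an odd one: convolution with the even kernel preserves the odd parity of
`d'`. -/
lemma integral_mul_conv_lnAbs_deriv_of_even {d : Test} (hd : ∀ x, d (-x) = d x) : ∫ x, d x * conv lnAbs d.deriv x = 0 := by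
  refine integral_eq_zero_of_odd fun x => ?_
  rw [conv_lnAbs_neg, reflect_deriv_of_even hd, conv_neg, hd]
  ring

/-! ### The cross products at unit scale -/

/-- The representative of `X₋⁻² · H - Ln x₊ · D'` at unit scale. -/
def crossMinus (d : Test) (t : ℝ) : ℂ :=
  (-conv lnMinus d.deriv.deriv t + d.deriv t) * conv heaviside d t - conv lnPlus d t * d.deriv t

/-- The representative of `X₊⁻² · Ȟ + Ln x₋ · D'` at unit scale. -/
def crossPlus (d : Test) (t : ℝ) : ℂ :=
  (-conv lnPlus d.deriv.deriv t - d.deriv t) * conv heavisideRef d t + conv lnMinus d t * d.deriv t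

/-- Reflection exchanges the plus and minus singularities and changes the sign of `d'`, so the
second relation follows from the first. -/
lemma crossMinus_neg {d : Test} (hd : ∀ x, d (-x) = d x) (t : ℝ) :
    crossMinus d (-t) = crossPlus d t := by
  simp only [crossMinus, crossPlus, conv_lnMinus_neg, conv_lnPlus_neg, conv_heaviside_neg,
    deriv_neg_of_even hd, reflect_of_even hd, reflect_deriv_deriv_of_even hd]
  ring

lemma continuous_crossMinus (d : Test) : Continuous (crossMinus d) :=
  (((continuous_conv _ _).neg.add d.deriv.continuous).mul (continuous_conv _ _)).sub
    ((continuous_conv _ _).mul d.deriv.continuous)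

/-- The factors live on opposite half-lines: the first vanishes to the right of `l`, the second to
the left of `-l`. -/
lemma conv_lnMinus_mul_conv_heaviside_support {χ ψ : Test} {l : ℝ}
    (hχ : ∀ x, χ x ≠ 0 → |x| ≤ l) (hψ : ∀ x, ψ x ≠ 0 → |x| ≤ l) (x : ℝ)
    (hx : conv lnMinus χ x * conv heaviside ψ x ≠ 0) : |x| ≤ l := by
  refine abs_le.2 ⟨?_, ?_⟩
  · by_contra h
    exact right_ne_zero_of_mul hx (conv_heaviside_eq_zero hψ (not_le.1 h))
  · by_contra h
    exact left_ne_zero_of_mul hx (conv_lnMinus_eq_zero hχ (not_le.1 h))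

lemma crossMinus_support {d : Test} {l : ℝ} (hl : ∀ x, d x ≠ 0 → |x| ≤ l) (x : ℝ)
    (hx : crossMinus d x ≠ 0) : |x| ≤ l := by
  by_contra h
  have h1 : d.deriv x = 0 := by
    by_contra h'
    exact h (d.support_deriv hl x h')
  have h2 : conv lnMinus d.deriv.deriv x * conv heaviside d x = 0 := by
    by_contra h'
    exact h (conv_lnMinus_mul_conv_heaviside_support
      (d.deriv.support_deriv (d.support_deriv hl)) hl x h')
  apply hx
  simp only [crossMinus, h1]
  linear_combination -h2

/-- A primitive of `crossMinus` up to terms without second derivatives. -/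
def crossPrimitive (d : Test) (t : ℝ) : ℂ :=
  (-conv lnMinus d.deriv t + d t) * conv heaviside d t - conv lnPlus d t * d t

lemma crossPrimitive_support {d : Test} {l : ℝ} (hl : ∀ x, d x ≠ 0 → |x| ≤ l) (x : ℝ)
    (hx : crossPrimitive d x ≠ 0) : |x| ≤ l := by
  by_contra h
  have h1 : d x = 0 := by
    by_contra h'
    exact h (hl x h')
  have h2 : conv lnMinus d.deriv x * conv heaviside d x = 0 := by
    by_contra h'
    exact h (conv_lnMinus_mul_conv_heaviside_support (d.support_deriv hl) hl x h')
  apply hx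
  simp only [crossPrimitive, h1]
  linear_combination -h2

lemma continuous_crossPrimitive (d : Test) : Continuous (crossPrimitive d) :=
  (((continuous_conv _ _).neg.add d.continuous).mul (continuous_conv _ _)).sub
    ((continuous_conv _ _).mul d.continuous)

/-- Besides `crossMinus d`, the product rule leaves the term with `(θ * d)' = d` and the one from
differentiating `ln x₊ * d`. In these the two one-sided logarithms combine into `ln |x|`. -/
lemma crossPrimitive_hasDerivAt (d : Test) (x : ℝ) :
    HasDerivAt (crossPrimitive d) (crossMinus d x + (d x ^ 2 - d x * conv lnAbs d.deriv x)) x := by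
  have hH := conv_hasDerivAt heaviside d x
  rw [conv_heaviside_deriv] at hH
  have h := (((conv_hasDerivAt lnMinus d.deriv x).neg.add (d.hasDerivAt x)).mul hH).sub
    ((conv_hasDerivAt lnPlus d x).mul (d.hasDerivAt x))
  refine h.congr_deriv ?_
  simp only [← conv_lnMinus_add_conv_lnPlus, crossMinus, Pi.add_apply, Pi.neg_apply]
  ring

lemma Test.integrable_sq (d : Test) : Integrable fun x => d x ^ 2 := by
  simpa only [sq] using d.integrable_mul d.continuous.locallyIntegrable

/-- The `1/2` is `∫ d (θ * d)`. Integration by parts moves the derivative off `ln x₋ * d'`, and the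
resulting `∫ d (ln x₋ * d)` cancels `∫ d (ln x₊ * d)` by reflection. -/
lemma integral_crossPrimitive {d : Test} (hd : ∀ x, d (-x) = d x) (h1 : ∫ x, d x = 1) :
    ∫ x, crossPrimitive d x = 1 / 2 := by
  obtain ⟨l, hl⟩ := d.exists_support
  have i1 := integrable_test_mul_conv d d lnMinus
  have i2 := integrable_test_mul_conv d d lnPlus
  have i3 := integrable_test_mul_conv d d heaviside
  have i4 : Integrable fun x => conv lnMinus d.deriv x * conv heaviside d x :=
    integrable_of_support ((continuous_conv _ _).mul (continuous_conv _ _))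
      (conv_lnMinus_mul_conv_heaviside_support (d.support_deriv hl) hl)
  have h2 : (∫ x, conv lnMinus d.deriv x * conv heaviside d x) +
      ∫ x, d x * conv lnMinus d x = 0 := by
    rw [← integral_add i4 i1]
    refine integral_eq_zero_of_hasDerivAt_of_integrable
      (f := fun x => conv lnMinus d x * conv heaviside d x) (fun x => ?_) (i4.add i1)
      (integrable_of_support ((continuous_conv _ _).mul (continuous_conv _ _))
        (conv_lnMinus_mul_conv_heaviside_support hl hl))
    have hH := conv_hasDerivAt heaviside d x
    rw [conv_heaviside_deriv] at hH
    refine ((conv_hasDerivAt lnMinus d x).mul hH).congr_deriv ?_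
    ring
  have e : ∀ x, crossPrimitive d x = d x * conv heaviside d x -
      conv lnMinus d.deriv x * conv heaviside d x - d x * conv lnPlus d x := fun x => by
    simp only [crossPrimitive]; ring
  simp_rw [e]
  rw [integral_sub (integrable_fun_sub i3 i4) i2, integral_sub i3 i4, integral_mul_conv_heaviside hd h1,
    integral_mul_conv_lnPlus_eq hd]
  linear_combination -h2

lemma integrable_crossMinus (d : Test) : Integrable (crossMinus d) := by
  obtain ⟨l, hl⟩ := d.exists_support
  exact integrable_of_support (continuous_crossMinus d) (crossMinus_support hl)

lemma integrable_mul_crossMinus (d : Test) : Integrable fun x : ℝ => (x : ℂ) * crossMinus d x := by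
  obtain ⟨l, hl⟩ := d.exists_support
  exact integrable_of_support (Complex.continuous_ofReal.mul (continuous_crossMinus d))
    fun x hx => crossMinus_support hl x (right_ne_zero_of_mul hx)

lemma integrable_crossPrimitive (d : Test) : Integrable (crossPrimitive d) := by
  obtain ⟨l, hl⟩ := d.exists_support
  exact integrable_of_support (continuous_crossPrimitive d) (crossPrimitive_support hl)

lemma integral_crossMinus {d : Test} (hd : ∀ x, d (-x) = d x) :
    ∫ x, crossMinus d x = -∫ x, d x ^ 2 := by
  have i1 := integrable_crossMinus d
  have i2 := d.integrable_sq
  have i3 := integrable_test_mul_conv d d.deriv lnAbs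
  have h := integral_eq_zero_of_hasDerivAt_of_integrable (crossPrimitive_hasDerivAt d)
    (i1.add (i2.sub i3)) (integrable_crossPrimitive d)
  rw [integral_add i1 (integrable_fun_sub i2 i3), integral_sub i2 i3,
    integral_mul_conv_lnAbs_deriv_of_even hd] at h
  linear_combination h

/-- Integrating the derivative of `x` times the primitive, the integral `1/2` of the primitive is
balanced by the value `(∫ d)² / 2` of the logarithmic term; `x d²` is odd. -/
lemma integral_mul_crossMinus {d : Test} (hd : ∀ x, d (-x) = d x) (h1 : ∫ x, d x = 1) :
    ∫ x : ℝ, (x : ℂ) * crossMinus d x = 0 := by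
  obtain ⟨l, hl⟩ := d.exists_support
  have i0 := integrable_crossPrimitive d
  have i1 := integrable_mul_crossMinus d
  have i2 : Integrable fun x : ℝ => d.mulX x * d x :=
    d.mulX.integrable_mul d.continuous.locallyIntegrable
  have i3 := integrable_test_mul_conv d.mulX d.deriv lnAbs
  have hder : ∀ x : ℝ, HasDerivAt (fun x : ℝ => (x : ℂ) * crossPrimitive d x)
      (crossPrimitive d x + ((x : ℂ) * crossMinus d x + (d.mulX x * d x -
        d.mulX x * conv lnAbs d.deriv x))) x := by
    intro x
    have h := (Complex.ofRealCLM.hasDerivAt (x := x)).mul (crossPrimitive_hasDerivAt d x)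
    refine h.congr_deriv ?_
    simp only [Complex.ofRealCLM_apply, Complex.ofReal_one, Test.mulX_apply]
    ring
  have h := integral_eq_zero_of_hasDerivAt_of_integrable hder
    (i0.add (i1.add (i2.sub i3)))
    (integrable_of_support (Complex.continuous_ofReal.mul (continuous_crossPrimitive d))
      fun x hx => crossPrimitive_support hl x (right_ne_zero_of_mul hx))
  have h2 : ∫ x : ℝ, d.mulX x * d x = 0 := by
    refine integral_eq_zero_of_odd fun x => ?_
    simp [hd]
  rw [integral_add i0 (i1.fun_add (integrable_fun_sub i2 i3)), integral_add i1 (integrable_fun_sub i2 i3), integral_sub i2 i3,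
    integral_crossPrimitive hd h1, integral_mulX_mul_conv_lnAbs_deriv, h1, h2] at h
  linear_combination h

/-! ### Concentration at the origin -/

lemma norm_integral_mul_le {f η : ℝ → ℂ} {l M B : ℝ} (hM : ∀ x, |x| ≤ l → ‖f x‖ ≤ M)
    (hl0 : 0 ≤ l) (hM0 : 0 ≤ M) (hf : ∀ x, f x ≠ 0 → |x| ≤ l) (hη : ∀ x, |x| ≤ l → ‖η x‖ ≤ B) :
    ‖∫ x, f x * η x‖ ≤ M * B * (2 * l) := by
  have e : ∫ x, f x * η x = ∫ x in Set.Icc (-l) l, f x * η x := by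
    refine (setIntegral_eq_integral_of_forall_compl_eq_zero fun x hx => ?_).symm
    by_contra h
    exact hx (abs_le.1 (hf x (left_ne_zero_of_mul h)))
  rw [e]
  refine (norm_setIntegral_le_of_norm_le_const (C := M * B) (by simp) fun x hx => ?_).trans (le_of_eq ?_)
  · have hx' := abs_le.2 hx
    rw [norm_mul]
    exact mul_le_mul (hM x hx') (hη x hx') (norm_nonneg _) hM0
  · rw [Real.volume_real_Icc_of_le (by linarith)]
    ring

/-- If `f_σ` is supported in a fixed interval and uniformly bounded, and has first moment `0`
and integral `c σ`, then `σ⁻¹ ∫ f_σ(t) ψ(σ t) dt → c ψ(0)`. -/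
lemma tendsto_of_moments {f : ℝ → ℝ → ℂ} {l M : ℝ} {c : ℂ}
    (hcont : ∀ σ, Continuous (f σ))
    (hl : ∀ᶠ σ in 𝓝[>] (0 : ℝ), ∀ x, f σ x ≠ 0 → |x| ≤ l)
    (hM : ∀ᶠ σ in 𝓝[>] (0 : ℝ), ∀ x, |x| ≤ l → ‖f σ x‖ ≤ M)
    (h0 : ∀ σ > 0, ∫ x, f σ x = c * σ) (h1 : ∀ σ > 0, ∫ x : ℝ, (x : ℂ) * f σ x = 0) (ψ : Test) :
    Tendsto (fun σ : ℝ => (σ⁻¹ : ℂ) * ∫ t, f σ t * ψ (σ * t)) (𝓝[>] 0) (𝓝 (c * ψ 0)) := by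
  obtain ⟨B, hB0, hB⟩ := ψ.exists_bound 2
  rw [tendsto_iff_norm_sub_tendsto_zero]
  have hlim : Tendsto (fun σ : ℝ => |M| * (B * |l| ^ 2) * (2 * |l|) * σ) (𝓝[>] 0) (𝓝 0) := by
    have : Tendsto (fun σ : ℝ => |M| * (B * |l| ^ 2) * (2 * |l|) * σ) (𝓝 0)
        (𝓝 (|M| * (B * |l| ^ 2) * (2 * |l|) * 0)) := tendsto_id.const_mul _
    rw [mul_zero] at this
    exact this.mono_left nhdsWithin_le_nhds
  refine squeeze_zero' (.of_forall fun _ => norm_nonneg _) ?_ hlim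
  filter_upwards [hl, hM, self_mem_nhdsWithin] with σ hl hM (hσ : 0 < σ)
  have hc : (σ : ℂ) ≠ 0 := by exact_mod_cast hσ.ne'
  -- A negative `l` forces `f σ = 0`, and then the integral condition forces `c = 0`.
  rcases lt_or_ge l 0 with hneg | hl0
  · have hz : ∀ x, f σ x = 0 := fun x => by
      by_contra h
      exact absurd ((abs_nonneg x).trans (hl x h)) (not_le.2 hneg)
    have h := h0 σ hσ
    simp only [hz, integral_zero] at h
    have hc0 : c = 0 := (mul_eq_zero.1 h.symm).resolve_right hc
    simp only [hz, hc0, zero_mul, integral_zero, mul_zero, sub_zero, norm_zero]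
    positivity
  have i1 := integrable_of_support (hcont σ) hl
  have i2 : Integrable fun x : ℝ => (x : ℂ) * f σ x :=
    integrable_of_support (Complex.continuous_ofReal.mul (hcont σ))
      fun x hx => hl x (right_ne_zero_of_mul hx)
  have i3 : Integrable fun x : ℝ => f σ x * ψ (σ * x) :=
    integrable_of_support ((hcont σ).mul (ψ.continuous.comp (continuous_const.mul continuous_id)))
      fun x hx => hl x (left_ne_zero_of_mul hx)
  -- The moment conditions evaluate the linear Taylor polynomial of `ψ` exactly. The remainder is
  -- `O(σ²)`, so `O(σ)` survives the factor `σ⁻¹`.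
  have e : ∫ t : ℝ, f σ t * (ψ (σ * t) - ψ 0 - (σ * t : ℝ) * ψ.deriv 0) =
      (∫ t, f σ t * ψ (σ * t)) - c * σ * ψ 0 := by
    have e1 : ∀ t : ℝ, f σ t * (ψ (σ * t) - ψ 0 - (σ * t : ℝ) * ψ.deriv 0) =
        f σ t * ψ (σ * t) - f σ t * ψ 0 - (t * f σ t) * (σ * ψ.deriv 0) := fun t => by
      push_cast; ring
    simp_rw [e1]
    rw [integral_sub (integrable_fun_sub i3 (i1.mul_const _)) (i2.mul_const _), integral_sub i3 (i1.mul_const _),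
      integral_mul_const, integral_mul_const, h0 σ hσ, h1 σ hσ]
    ring
  have hb : ‖∫ t : ℝ, f σ t * (ψ (σ * t) - ψ 0 - (σ * t : ℝ) * ψ.deriv 0)‖ ≤
      |M| * (B * (σ * |l|) ^ 2) * (2 * |l|) := by
    rw [abs_of_nonneg hl0]
    refine norm_integral_mul_le (fun x hx => (hM x hx).trans (le_abs_self M)) hl0 (abs_nonneg M)
      hl fun x hx => ?_
    have h := taylor_bound ψ 0 hB 0 (σ * x)
    simp only [iteratedDeriv_zero, zero_add, iteratedDeriv_one, ← Test.coe_deriv] at h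
    refine h.trans ?_
    gcongr ?_ * ?_
    rw [← sq_abs (σ * x), abs_mul, abs_of_pos hσ]
    gcongr
  have e3 : (σ⁻¹ : ℂ) * (∫ t, f σ t * ψ (σ * t)) - c * ψ 0 =
      (σ⁻¹ : ℂ) * ∫ t : ℝ, f σ t * (ψ (σ * t) - ψ 0 - (σ * t : ℝ) * ψ.deriv 0) := by
    rw [e]
    field_simp
  rw [e3, norm_mul, norm_inv, Complex.norm_real, Real.norm_eq_abs, abs_of_pos hσ]
  calc σ⁻¹ * _ ≤ σ⁻¹ * (|M| * (B * (σ * |l|) ^ 2) * (2 * |l|)) := by gcongr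
    _ = |M| * (B * |l| ^ 2) * (2 * |l|) * σ := by
      field_simp

/-! ### Association -/

lemma tendsto_size_scale (φ : A 0) :
    Tendsto (fun ε : ℝ => size (scale ε φ)) (𝓝[>] 0) (𝓝[>] 0) := by
  refine tendsto_nhdsWithin_iff.2 ⟨?_, .of_forall fun ε => size_pos _⟩
  have : Tendsto (fun ε : ℝ => ε * size φ) (𝓝 0) (𝓝 (0 * size φ)) := tendsto_id.mul_const _
  rw [zero_mul] at this
  refine (this.mono_left nhdsWithin_le_nhds).congr' ?_
  filter_upwards [self_mem_nhdsWithin] with ε hε using (size_scale hε φ).symm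

/-- A generalized function whose representative is `s(φ)⁻² f(s(φ), x / s(φ))`, where `f(σ, ·)` is
bounded with supports in a fixed interval, has integral `c σ` and first moment `0`, is associated
with `c δ`. -/
lemma assoc_of_moments {X : Moderate} {f : ℝ → ℝ → ℂ} {l M : ℝ} {c : ℂ}
    (hX : ∀ (φ : A 0) (t : ℝ), X.1 φ (size φ * t) = ((size φ : ℂ)⁻¹) ^ 2 * f (size φ) t)
    (hcont : ∀ σ, Continuous (f σ))
    (hl : ∀ᶠ σ in 𝓝[>] (0 : ℝ), ∀ x, f σ x ≠ 0 → |x| ≤ l)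
    (hM : ∀ᶠ σ in 𝓝[>] (0 : ℝ), ∀ x, |x| ≤ l → ‖f σ x‖ ≤ M)
    (h0 : ∀ σ > 0, ∫ x, f σ x = c * σ) (h1 : ∀ σ > 0, ∫ x : ℝ, (x : ℂ) * f σ x = 0) :
    Assoc (Ideal.Quotient.mk Null X) (c • delta) := by
  -- `q = 0` suffices: the representative depends on `φ` only through `s(φ)`, so vanishing moments
  -- of `φ` play no role.
  refine ⟨X.1, X.2, rfl, fun ψ => ⟨0, fun φ _ => ?_⟩⟩
  refine ((tendsto_of_moments hcont hl hM h0 h1 ψ).comp (tendsto_size_scale φ)).congr fun ε => ?_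
  have hσ := size_pos (scale ε φ)
  have hc : (size (scale ε φ) : ℂ) ≠ 0 := by exact_mod_cast hσ.ne'
  have h := Measure.integral_comp_mul_left (fun x => X.1 (scale ε φ) x * ψ x) (size (scale ε φ))
  simp only [hX, mul_assoc, integral_const_mul] at h
  rw [abs_of_pos (inv_pos.2 hσ), Complex.real_smul] at h
  push_cast at h
  simp only [Function.comp_apply]
  refine mul_left_cancel₀ (inv_ne_zero hc) (Eq.trans ?_ h)
  ring

/-! ### The cross products under dilation -/

lemma neg_one_smul_delta : (-1 : ℂ) • delta = -delta :=
  ContinuousLinearMap.ext fun ψ => neg_one_mul (ψ 0)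

lemma conv_add_left (u v : Distr) (χ : Test) (x : ℝ) :
    conv (u + v) χ x = conv u χ x + conv v χ x := rfl

lemma conv_smul_left (c : ℂ) (u : Distr) (χ : Test) (x : ℝ) :
    conv (c • u) χ x = c * conv u χ x := rfl

lemma conv_negPowMinus_one (χ : Test) (x : ℝ) :
    conv (negPowMinus 1) χ x = -conv lnMinus χ.deriv.deriv x + χ.deriv x := by
  simp [negPowMinus, kappa, conv_add_left, conv_smul_left, conv_deriv]

lemma conv_negPowPlus_one (χ : Test) (x : ℝ) :
    conv (negPowPlus 1) χ x = -conv lnPlus χ.deriv.deriv x - χ.deriv x := by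
  simp [negPowPlus, kappa, conv_add_left, conv_smul_left, conv_deriv]
  ring

/-- Since the mirrored step function convolved with `d''` is `-d'`, the first product contributes
`ln σ · d' (θ * d)`. The term `Ln x₊ · D'` subtracts exactly the same, so pure scaling remains. -/
lemma crossMinus_dilate (d : Test) {σ : ℝ} (hσ : 0 < σ) (t : ℝ) :
    crossMinus (dilate σ d) (σ * t) = ((σ : ℂ)⁻¹) ^ 2 * crossMinus d t := by
  simp only [crossMinus, Test.deriv_dilate, Test.deriv_smul, conv_smul,
    conv_lnMinus_dilate _ hσ, conv_lnPlus_dilate _ hσ, conv_heaviside_dilate _ hσ,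
    conv_heavisideRef_deriv]
  have e : ((σ⁻¹ : ℂ) • dilate σ d.deriv) (σ * t) = (σ⁻¹ : ℂ) * ((σ⁻¹ : ℂ) * d.deriv t) := by
    change (σ⁻¹ : ℂ) * ((σ⁻¹ : ℂ) * d.deriv (σ⁻¹ * (σ * t))) = _
    rw [inv_mul_cancel_left₀ hσ.ne']
  rw [e]
  ring

lemma crossPlus_dilate {d : Test} (hd : ∀ x, d (-x) = d x) {σ : ℝ} (hσ : 0 < σ) (t : ℝ) :
    crossPlus (dilate σ d) (σ * t) = ((σ : ℂ)⁻¹) ^ 2 * crossPlus d t := by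
  have hd' : ∀ x, dilate σ d (-x) = dilate σ d x := fun x => by simp [hd]
  rw [← crossMinus_neg hd', ← crossMinus_neg hd, ← mul_neg, crossMinus_dilate d hσ]

/-! ### The four associations -/

namespace DeltaModel

variable (D : DeltaModel)

lemma exists_conv_bound (u : Distr) (m : ℕ) (R : ℝ) :
    ∃ C : ℝ, ∀ᶠ s in 𝓝[>] (0 : ℝ), ∀ x, |x| ≤ R →
      ‖conv u (Test.deriv^[m] (D.profile s)) x‖ ≤ C := by
  obtain ⟨l, hl⟩ := D.support_bounded
  exact conv_bounded u hl D.deriv_bounded m R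

lemma exists_crossMinus_bound (R : ℝ) :
    ∃ C : ℝ, ∀ᶠ s in 𝓝[>] (0 : ℝ), ∀ x, |x| ≤ R → ‖crossMinus (D.profile s) x‖ ≤ C := by
  obtain ⟨C₁, h₁⟩ := D.exists_conv_bound lnMinus 2 R
  -- Convolution with `δ` is the identity, so this bounds `d'` itself.
  obtain ⟨C₂, h₂⟩ := D.exists_conv_bound delta 1 R
  obtain ⟨C₃, h₃⟩ := D.exists_conv_bound heaviside 0 R
  obtain ⟨C₄, h₄⟩ := D.exists_conv_bound lnPlus 0 R
  refine ⟨(C₁ + C₂) * C₃ + C₄ * C₂, ?_⟩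
  filter_upwards [h₁, h₂, h₃, h₄] with s h₁ h₂ h₃ h₄ x hx
  have k₁ := h₁ x hx
  have k₂ := h₂ x hx
  have k₃ := h₃ x hx
  have k₄ := h₄ x hx
  simp only [Function.iterate_succ, Function.iterate_zero, Function.comp_apply, id_eq,
    conv_delta] at k₁ k₂ k₃ k₄
  refine norm_sub_le_of_le ?_ ?_
  · rw [norm_mul]
    have k₅ := norm_add_le_of_le (norm_neg (conv lnMinus _ x) ▸ k₁) k₂
    exact mul_le_mul k₅ k₃ (norm_nonneg _) ((norm_nonneg _).trans k₅)
  · rw [norm_mul]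
    exact mul_le_mul k₄ k₂ (norm_nonneg _) ((norm_nonneg _).trans k₄)

lemma integral_profile_sq {s : ℝ} (hs : 0 < s) : ∫ x, D.profile s x ^ 2 = s := by
  have hc : (s : ℂ) ≠ 0 := by exact_mod_cast hs.ne'
  have h := D.integral_sq s hs
  field_simp at h
  exact h

/-- The model of a distribution, as a moderate function. -/
def moderateRep (u : Distr) : Moderate := ⟨D.rep u, D.isModerate_rep u⟩

lemma rep_eq_conv (u : Distr) (φ : A 0) (x : ℝ) :
    D.rep u φ x = conv u (dilate (size φ) (D.profile (size φ))) x := rfl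

lemma rep_delta_scaled (φ : A 0) (t : ℝ) :
    D.rep delta φ (size φ * t) = (size φ : ℂ)⁻¹ * D.profile (size φ) t := by
  rw [rep_eq_conv, conv_delta, dilate_apply, inv_mul_cancel_left₀ (size_pos φ).ne']

lemma assoc_delta : Assoc (D.model delta) delta := by
  obtain ⟨l, hl⟩ := D.support_bounded
  obtain ⟨C, hC⟩ := D.deriv_bounded 0
  have h := assoc_of_moments (X := D.moderateRep delta)
    -- The model of `δ` scales like `σ⁻¹`; the extra `σ` adapts it to the prefactor `σ⁻²` and makes
    -- the integral `σ`.
    (f := fun σ t => σ * D.profile σ t) (c := 1) (l := l) (M := C) (fun φ t => ?_)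
    (fun σ => continuous_const.mul (D.profile σ).continuous) ?_ ?_ (fun σ hσ => ?_)
    (fun σ hσ => ?_)
  · rwa [one_smul] at h
  · have hc : (size φ : ℂ) ≠ 0 := by exact_mod_cast (size_pos φ).ne'
    change D.rep delta φ (size φ * t) = _
    rw [rep_delta_scaled]
    field_simp
  · filter_upwards [hl] with σ hl x hx using hl x (right_ne_zero_of_mul hx)
  · filter_upwards [hC, eventually_small] with σ hC ⟨h0, h1⟩ x _
    have := hC x
    rw [iteratedDeriv_zero] at this
    rw [norm_mul, Complex.norm_real, Real.norm_eq_abs, abs_of_pos h0]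
    exact (mul_le_of_le_one_left (norm_nonneg _) h1.le).trans this
  · rw [integral_const_mul, D.integral_eq σ hσ]
    ring
  · refine integral_eq_zero_of_odd fun x => ?_
    rw [D.even σ hσ]
    push_cast
    ring

lemma assoc_delta_sq : Assoc (D.model delta ^ 2) delta := by
  obtain ⟨l, hl⟩ := D.support_bounded
  obtain ⟨C, hC⟩ := D.deriv_bounded 0
  have h := assoc_of_moments (X := D.moderateRep delta ^ 2)
    (f := fun σ t => D.profile σ t ^ 2) (c := 1) (l := l) (M := C ^ 2) (fun φ t => ?_)
    (fun σ => (D.profile σ).continuous.pow 2) ?_ ?_ (fun σ hσ => ?_)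
    (fun σ hσ => ?_)
  · rwa [one_smul, RingHom.map_pow] at h
  · change D.rep delta φ (size φ * t) ^ 2 = _
    rw [rep_delta_scaled, mul_pow]
  · filter_upwards [hl] with σ hl x hx using hl x (ne_zero_pow two_ne_zero hx)
  · filter_upwards [hC] with σ hC x _
    have := hC x
    rw [iteratedDeriv_zero] at this
    rw [norm_pow]
    gcongr
  · rw [D.integral_profile_sq hσ, one_mul]
  · refine integral_eq_zero_of_odd fun x => ?_
    rw [D.even σ hσ]
    push_cast
    ring

lemma assoc_crossMinus :
    Assoc (D.model (negPowMinus 1) * D.model heaviside - D.model lnPlus * D.model delta.deriv)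
      (-delta) := by
  obtain ⟨l, hl⟩ := D.support_bounded
  obtain ⟨C, hC⟩ := D.exists_crossMinus_bound l
  have h := assoc_of_moments (X := D.moderateRep (negPowMinus 1) * D.moderateRep heaviside -
      D.moderateRep lnPlus * D.moderateRep delta.deriv)
    (f := fun σ => crossMinus (D.profile σ)) (c := -1) (fun φ t => ?_)
    (fun σ => continuous_crossMinus _) ?_ hC (fun σ hσ => ?_)
    (fun σ hσ => integral_mul_crossMinus (D.even σ hσ) (D.integral_eq σ hσ))
  · rwa [neg_one_smul_delta, RingHom.map_sub, RingHom.map_mul, RingHom.map_mul] at h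
  · rw [← crossMinus_dilate _ (size_pos φ)]
    change D.rep _ φ _ * D.rep _ φ _ - D.rep _ φ _ * D.rep _ φ _ = _
    simp only [rep_eq_conv, conv_negPowMinus_one, conv_deriv, conv_delta, crossMinus]
  · filter_upwards [hl] with σ hl using crossMinus_support hl
  · rw [integral_crossMinus (D.even σ hσ), D.integral_profile_sq hσ, neg_one_mul]

lemma assoc_crossPlus :
    Assoc (D.model (negPowPlus 1) * D.model heavisideRef + D.model lnMinus * D.model delta.deriv)
      (-delta) := by
  obtain ⟨l, hl⟩ := D.support_bounded
  obtain ⟨C, hC⟩ := D.exists_crossMinus_bound l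
  have h := assoc_of_moments (X := D.moderateRep (negPowPlus 1) * D.moderateRep heavisideRef +
      D.moderateRep lnMinus * D.moderateRep delta.deriv)
    -- Using the reflected function transfers bounds and moments from the first relation by `t ↦
    -- -t`.
    (f := fun σ t => crossMinus (D.profile σ) (-t)) (c := -1) (l := l) (M := C) (fun φ t => ?_)
    (fun σ => (continuous_crossMinus _).comp continuous_neg) ?_ ?_ (fun σ hσ => ?_)
    (fun σ hσ => ?_)
  · rwa [neg_one_smul_delta, RingHom.map_add, RingHom.map_mul, RingHom.map_mul] at h
  · have hd := D.even _ (size_pos φ)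
    rw [crossMinus_neg hd, ← crossPlus_dilate hd (size_pos φ)]
    change D.rep _ φ _ * D.rep _ φ _ + D.rep _ φ _ * D.rep _ φ _ = _
    simp only [rep_eq_conv, conv_negPowPlus_one, conv_deriv, conv_delta, crossPlus]
  · filter_upwards [hl] with σ hl x hx
    simpa using crossMinus_support hl _ hx
  · filter_upwards [hC] with σ hC x hx using hC _ (by simpa using hx)
  · rw [integral_neg_eq_self (crossMinus (D.profile σ)), integral_crossMinus (D.even σ hσ),
      D.integral_profile_sq hσ, neg_one_mul]
  · have h1 := integral_mul_crossMinus (D.even σ hσ) (D.integral_eq σ hσ)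
    rw [← integral_neg_eq_self] at h1
    simpa [integral_neg] using h1

end DeltaModel

end

end Colombeau

theorem theorem1 (D : Colombeau.DeltaModel) :
    -- `D ≈ δ` and `D² ≈ δ`
    Colombeau.Assoc (D.model Colombeau.delta) Colombeau.delta ∧
    Colombeau.Assoc (D.model Colombeau.delta ^ 2) Colombeau.delta ∧
    -- `X₋⁻² · H - Ln x₊ · D' ≈ -δ`
    Colombeau.Assoc
      (D.model (Colombeau.negPowMinus 1) * D.model Colombeau.heaviside
        - D.model Colombeau.lnPlus * D.model Colombeau.delta.deriv)
      (-Colombeau.delta) ∧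
    -- `X₊⁻² · Ȟ + Ln x₋ · D' ≈ -δ`
    Colombeau.Assoc
      (D.model (Colombeau.negPowPlus 1) * D.model Colombeau.heavisideRef
        + D.model Colombeau.lnMinus * D.model Colombeau.delta.deriv)
      (-Colombeau.delta) :=
  ⟨D.assoc_delta, D.assoc_delta_sq, D.assoc_crossMinus, D.assoc_crossPlus⟩
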